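/- Let $\lambda^*,\mu>0$ and put $\rho=\lambda^*/\mu$. Let $Y$ be a random batch size with values in $\{1,\dots,b\}$, $p_j=\mathbb P\{Y=j\}$, $\phi_Y(x)=\sum_{j=1}^b p_jx^j$, and assume the ergodicity condition $\rho<\mathbb E\,Y=\sum_{j=1}^b jp_j$. Consider single-server queues in which customers arrive one at a time and, while the system is not empty, services are completed at the epochs of independent exponential($\mu$) times; at a service completion a batch of independent size $Y$ leaves, or all customers present if there are fewer than $Y$. * In the $E_k/M^Y/1$-queue ($k\ge 1$) the inter-arrival times are Erlang: $k$ consecutive exponential phases of rate $k\lambda^*$ each (mean $1/\lambda^*$). Its state is $(m,i)$, with $m\ge 0$ the number of customers and $i\in\{0,\dots,k-1\}$ the number of arrival phases completed by the next customer; this is a continuous-time Markov chain. If $\pi^k$ is its stationary distribution, let $\bar\pi^k_m=\sum_{i=0}^{k-1}\pi^k_{(m,i)}$. * In the $D/M^Y/1$-queue the inter-arrival times are all equal to $1/\lambda^*$. The pair (number of customers, time since the last arrival) is a Markov process on $\mathbb N\times[0,1/\lambda^*)$. Let $\bar\pi^D$ be the law of the number of customers under its stationary distribution. **Theorem.** These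 stationary distributions exist and are unique, the equation $$\sigma=e^{-(1-\phi_Y(\sigma))/\rho}$$ has exactly one real root $\sigma<1$, and the following holds. (i) $\bar\pi^k_m\to\bar\pi^D_m$ as $k\to\infty$, for every $m=0,1,2,\dots$ (ii) $\displaystyle \bar\pi^D_m=\frac{\rho(1-\sigma)^2}{1-\phi_Y(\sigma)}\,\sigma^{m-1}$ for $m>0$, and $\displaystyle \bar\pi^D_0=1-\frac{\rho(1-\sigma)}{1-\phi_Y(\sigma)}$. -/

import Mathlib

open MeasureTheory ProbabilityTheory Filter Topology

namespace BatchQueue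

noncomputable section

/-- The probability generating function `φ_Y(x) = ∑_{j=1}^b p_j x^j` of the batch size. -/
def batchPGF (p : PMF ℕ) (b : ℕ) (x : ℝ) : ℝ :=
  ∑ j ∈ Finset.Icc 1 b, (p j).toReal * x ^ j

/-- The mean batch size `E Y = ∑_{j=1}^b j p_j`. -/
def batchMean (p : PMF ℕ) (b : ℕ) : ℝ :=
  ∑ j ∈ Finset.Icc 1 b, (j : ℝ) * (p j).toReal

/-- The law of the number of customers right after one service completion that finds `m`
customers: a batch of size `Y ∼ p` leaves, and all customers leave if `Y ≥ m`
(the subtraction is truncated at `0`). -/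
def serviceStep (p : PMF ℕ) (m : ℕ) : PMF ℕ :=
  p.map (fun j => m - j)

/-! ### The queue with Erlang inter-arrival times, as a continuous-time Markov chain -/

/-- The transition rates from `x = (m, i)` to `y ≠ x` in the queue with Erlang(`k`, `lam`)
inter-arrival times. Here `m` is the number of customers and `i` the number of arrival phases that
the next customer has completed. A phase ends at rate `lam`; the end of the last phase is an
arrival. If `m > 0`, services are completed at rate `mu`. -/
def erlangRate (lam mu : ℝ) (p : PMF ℕ) (k : ℕ) (x y : ℕ × Fin k) : ℝ :=
  (if (x.2 : ℕ) + 1 < k then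
      (if y.1 = x.1 ∧ (y.2 : ℕ) = (x.2 : ℕ) + 1 then lam else 0)
    else
      (if y.1 = x.1 + 1 ∧ (y.2 : ℕ) = 0 then lam else 0)) +
  (if 0 < x.1 ∧ y.2 = x.2 then mu * (serviceStep p x.1 y.1).toReal else 0)

/-- The generator (`q`-matrix): transition rates off the diagonal, and minus the total jump rate
on the diagonal. -/
def erlangGenerator (lam mu : ℝ) (p : PMF ℕ) (k : ℕ) (x y : ℕ × Fin k) : ℝ :=
  if x = y then -(lam + if 0 < x.1 then mu else 0) else erlangRate lam mu p k x y

/-- `π` is a stationary distribution of the queue with Erlang(`k`, `lam`) inter-arrival times: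
a probability distribution with `π Q = 0`. The rates are bounded by `lam + mu`, so this is
invariance under the (non-explosive) chain. -/
def IsErlangStationary (lam mu : ℝ) (p : PMF ℕ) (k : ℕ) (π : ℕ × Fin k → ℝ) : Prop :=
  (∀ x, 0 ≤ π x) ∧ HasSum π 1 ∧
    ∀ y, HasSum (fun x => π x * erlangGenerator lam mu p k x y) 0

/-- The probability of having `m` customers in the system, `∑_{i<k} π_{(m,i)}`. -/
def levelProb {k : ℕ} (π : ℕ × Fin k → ℝ) (m : ℕ) : ℝ :=
  ∑ i : Fin k, π (m, i)

/-! ### The queue with deterministic inter-arrival times `T`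

Its state is `(m, s)`, with `m` the number of customers and `s ∈ [0, T)` the time since the last
arrival. This is a Markov process; its transition kernels are given explicitly. -/

/-- The law of the number of customers after a time `t` without arrivals, starting from `m`
customers: the times of service completions form a Poisson process of rate `mu`. (A completion
that finds an empty system changes nothing; the exponential law being memoryless, it is
immaterial whether the server is active then.) -/
def serve (mu : ℝ) (p : PMF ℕ) (t : ℝ) (m : ℕ) : PMF ℕ :=
  (poissonMeasure (mu * t).toNNReal).toPMF.bind
    (fun n => (fun q : PMF ℕ => q.bind (serviceStep p))^[n] (PMF.pure m))

/-- One full inter-arrival period, from right after an arrival to right after the next one. -/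
def cycle (mu : ℝ) (p : PMF ℕ) (T : ℝ) (q : PMF ℕ) : PMF ℕ :=
  (q.bind (serve mu p T)).map Nat.succ

/-- The law of the number of customers at time `t`, starting from `m` customers and a last arrival
`s` time units ago, when exactly `n` arrivals take place in `(0, t]` (at the times
`T - s, 2 T - s, …, n T - s`). -/
def customersAfter (mu : ℝ) (p : PMF ℕ) (T t : ℝ) (m : ℕ) (s : ℝ) : ℕ → PMF ℕ
  | 0 => serve mu p t m
  | n + 1 => ((cycle mu p T)^[n] ((serve mu p (T - s) m).map Nat.succ)).bind
      (serve mu p (s + t - (n + 1) * T))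

/-- The law of the state at time `t`, starting from the state `x = (m, s)`. The number of arrivals
in `(0, t]` is `⌊(s + t) / T⌋`. -/
def deterministicLaw (mu : ℝ) (p : PMF ℕ) (T t : ℝ) (x : ℕ × ℝ) : Measure (ℕ × ℝ) :=
  (customersAfter mu p T t x.1 x.2 ⌊(x.2 + t) / T⌋₊).toMeasure.map
    (fun m => (m, x.2 + t - ⌊(x.2 + t) / T⌋₊ * T))

theorem measurable_bind_apply {α : Type*} [MeasurableSpace α] {f : α → PMF ℕ}
    {g : α → ℕ → PMF ℕ} (hf : ∀ j, Measurable fun a => f a j)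
    (hg : ∀ i j, Measurable fun a => g a i j) (j : ℕ) :
    Measurable fun a => (f a).bind (g a) j := by
  simp only [PMF.bind_apply]
  exact Measurable.tsum fun i => (hf i).mul (hg i j)

theorem measurable_map_apply {α : Type*} [MeasurableSpace α] {f : α → PMF ℕ}
    (hf : ∀ j, Measurable fun a => f a j) (g : ℕ → ℕ) (j : ℕ) :
    Measurable fun a => (f a).map g j := by
  exact measurable_bind_apply (g := fun _ => PMF.pure ∘ g) hf (fun _ _ => measurable_const) j

theorem measurable_serve {α : Type*} [MeasurableSpace α] (mu : ℝ) (p : PMF ℕ) {f : α → ℝ}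
    (hf : Measurable f) (m j : ℕ) : Measurable fun a => serve mu p (f a) m j := by
  refine measurable_bind_apply (f := fun a => (poissonMeasure (mu * f a).toNNReal).toPMF)
    (g := fun _ n => (fun q : PMF ℕ => q.bind (serviceStep p))^[n] (PMF.pure m))
    (fun n => ?_) (fun _ _ => measurable_const) j
  simp only [Measure.toPMF_apply, poissonMeasure_singleton]
  refine ENNReal.measurable_ofReal.comp ?_
  have h : Measurable fun a => (((mu * f a).toNNReal : NNReal) : ℝ) :=
    (hf.const_mul mu).real_toNNReal.coe_nnreal_real
  exact ((Real.measurable_exp.comp h.neg).mul (h.pow_const n)).div_const _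

theorem measurable_customersAfter (mu : ℝ) (p : PMF ℕ) (T t : ℝ) (m n j : ℕ) :
    Measurable fun s => customersAfter mu p T t m s n j := by
  cases n with
  | zero => exact measurable_const
  | succ n =>
    have hcycle : ∀ (l : ℕ) (i : ℕ), Measurable fun s : ℝ =>
        (cycle mu p T)^[l] ((serve mu p (T - s) m).map Nat.succ) i := by
      intro l
      induction l with
      | zero =>
        exact fun i => measurable_map_apply
          (measurable_serve mu p (measurable_const.sub measurable_id) m) _ i
      | succ l ih =>
        intro i
        simp only [Function.iterate_succ_apply']
        exact measurable_map_apply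
          (measurable_bind_apply (g := fun _ => serve mu p T) ih fun _ _ => measurable_const) _ i
    exact measurable_bind_apply (hcycle n)
      (fun i => measurable_serve mu p ((measurable_id.add_const t).sub_const _) i) j

theorem measurable_deterministicLaw (mu : ℝ) (p : PMF ℕ) (T t : ℝ) :
    Measurable (deterministicLaw mu p T t) := by
  refine measurable_from_prod_countable_right fun m => ?_
  refine Measure.measurable_of_measurable_coe _ fun A hA => ?_
  have hfl : Measurable fun s : ℝ => ⌊(s + t) / T⌋₊ :=
    Nat.measurable_floor.comp ((measurable_id.add_const t).div_const T)
  have key : ∀ s : ℝ, deterministicLaw mu p T t (m, s) A =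
      ∑' j : ℕ, customersAfter mu p T t m s ⌊(s + t) / T⌋₊ j *
        A.indicator 1 (j, s + t - ⌊(s + t) / T⌋₊ * T) := by
    intro s
    rw [deterministicLaw, Measure.map_apply (measurable_of_countable _) hA,
      PMF.toMeasure_apply _ (measurable_of_countable _ hA)]
    refine tsum_congr fun j => ?_
    by_cases h : (j, s + t - ⌊(s + t) / T⌋₊ * T) ∈ A <;> simp [Set.indicator, h]
  simp only [key]
  refine Measurable.tsum fun j => Measurable.mul ?_ ?_
  · have h2 : Measurable fun q : ℕ × ℝ => customersAfter mu p T t m q.2 q.1 j :=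
      measurable_from_prod_countable_right fun n => measurable_customersAfter mu p T t m n j
    exact h2.comp (hfl.prodMk measurable_id)
  · refine (measurable_one.indicator hA).comp (measurable_const.prodMk ?_)
    exact (measurable_id.add_const t).sub
      (((measurable_of_countable (Nat.cast : ℕ → ℝ)).comp hfl).mul_const T)

/-- The transition kernel over a time `t` of the queue with deterministic inter-arrival
times `T`. -/
def deterministicKernel (mu : ℝ) (p : PMF ℕ) (T t : ℝ) : Kernel (ℕ × ℝ) (ℕ × ℝ) :=
  ⟨deterministicLaw mu p T t, measurable_deterministicLaw mu p T t⟩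

/-- `ν` is a stationary distribution of the queue with deterministic inter-arrival times `T`: a
probability measure on the state space `ℕ × [0, T)` that is invariant under the transition kernels
over all times. -/
def IsDeterministicStationary (mu : ℝ) (p : PMF ℕ) (T : ℝ) (ν : Measure (ℕ × ℝ)) : Prop :=
  IsProbabilityMeasure ν ∧ (∀ᵐ x ∂ν, x.2 ∈ Set.Ico 0 T) ∧
    ∀ t : ℝ, 0 ≤ t → (deterministicKernel mu p T t).Invariant ν

end

end BatchQueue

/-!
Everything rests on the modified geometric laws `G(σ, α)`, with mass `α (1 - σ) σ ^ (m - 1)` at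
`m > 0` and the remaining mass `1 - α` at `0` (`modGeom`). Mixing such laws with a common ratio `σ`
mixes the weights `α`, since the masses are affine in `α` (`bind_modGeomPMF`), and the departure of
a batch of size `j` multiplies the weight by `σ ^ j`. Hence a service completion multiplies the weight by
`φ_Y(σ)`, serving for a time `t` multiplies it by `exp (-μ (1 - φ_Y(σ)) t)`, and an arrival turns
`G(σ, σ)` into `G(σ, 1)`.

So in both queues a stationary distribution is found by letting the weight decay from `1`, right
after an arrival, to `σ`, right before the next one. With deterministic inter-arrival times `T`
the time `s` since the last arrival is uniform and the weight is `exp (-μ (1 - φ_Y(σ)) s)`; it is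
`σ` at `s = T` exactly if `σ = exp (-(1 - φ_Y(σ)) / ρ)`. With Erlang(`k`) times the phase `i` is
uniform and the weight is `z ^ (i + 1)`, where `z` is the Laplace transform of a phase at
`μ (1 - φ_Y(σ))` and `z ^ k = σ`. Averaging the weights over `s`, or over `i`, gives in both cases
the law `G(σ, ρ (1 - σ) / (1 - φ_Y(σ)))` of the number of customers. The limit theorem therefore
reduces to the convergence of the ratios (`tendsto_phase_root`), which are chosen as the least
fixed points of the respective transforms; these are smaller than `1` by the ergodicity condition.

Both uniqueness statements come from one fact on stochastic matrices, `invariant_unique_of_reaches`: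
if some state can be reached from every state, there is at most one invariant vector of mass one.
It applies directly to the uniformized Erlang chain. For the deterministic queue, the law of the
time since the last arrival is invariant under all rotations of the circle of length `T`, hence
uniform; and the transition over one period preserves that time, so that the conditional law of the
number of customers given `s` is, for almost every `s`, invariant under a stochastic matrix on `ℕ`
which can reach the state `1` from everywhere.
-/

namespace BatchQueue

noncomputable section

/-! ### Uniqueness of invariant vectors of a stochastic matrix -/

/-- If a summable signed vector `d` is invariant under a stochastic matrix, so is `|d|`: one has
`|d| ≤ |d| P` entrywise, and both sides have the same total mass. -/
theorem hasSum_abs_mul_of_invariant {E : Type*} {P : E → E → ℝ} (hP0 : ∀ x y, 0 ≤ P x y)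
    (hP1 : ∀ x, HasSum (P x) 1) {d : E → ℝ} (hd : Summable d)
    (hinv : ∀ y, HasSum (fun x => d x * P x y) (d y)) (y : E) :
    HasSum (fun x => |d x| * P x y) |d y| := by
  have hrow : ∀ x, HasSum (fun y => |d x| * P x y) |d x| := fun x => by
    simpa using (hP1 x).mul_left |d x|
  have hF : Summable fun q : E × E => |d q.1| * P q.1 q.2 :=
    (summable_prod_of_nonneg fun q => mul_nonneg (abs_nonneg _) (hP0 _ _)).2
      ⟨fun x => (hrow x).summable, hd.abs.congr fun x => ((hrow x).tsum_eq).symm⟩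
  have hcol : ∀ y, Summable fun x => |d x| * P x y := fun y => hF.prod_symm.prod_factor y
  have hle : ∀ y, |d y| ≤ ∑' x, |d x| * P x y := by
    intro y
    have h1 : Summable fun x => ‖d x * P x y‖ := by
      simpa [abs_mul, abs_of_nonneg (hP0 _ _)] using hcol y
    have h2 := norm_tsum_le_tsum_norm h1
    rw [(hinv y).tsum_eq] at h2
    simpa [abs_mul, abs_of_nonneg (hP0 _ _)] using h2
  have hs : Summable fun y => ∑' x, |d x| * P x y := hF.prod_symm.prod
  have htot : ∑' y, ∑' x, |d x| * P x y = ∑' x, |d x| := by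
    rw [hF.tsum_comm (f := fun x y => |d x| * P x y)]
    exact tsum_congr fun x => (hrow x).tsum_eq
  have hzero : HasSum (fun y => (∑' x, |d x| * P x y) - |d y|) 0 := by
    simpa [htot] using hs.hasSum.sub hd.abs.hasSum
  have h0 := (hasSum_zero_iff_of_nonneg fun y => sub_nonneg.2 (hle y)).1 hzero
  have h1 : ∑' x, |d x| * P x y = |d y| := sub_eq_zero.1 (congrFun h0 y)
  exact h1 ▸ (hcol y).hasSum

/-- The zeros of a nonnegative invariant vector propagate backwards along possible transitions. -/
theorem eq_zero_of_invariant_of_reaches {E : Type*} {P : E → E → ℝ} (hP0 : ∀ x y, 0 ≤ P x y)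
    {v : E → ℝ} (hv : ∀ x, 0 ≤ v x) (hinv : ∀ y, HasSum (fun x => v x * P x y) (v y)) {o x : E}
    (ho : v o = 0) (hx : Relation.ReflTransGen (fun x y => 0 < P x y) x o) : v x = 0 := by
  induction hx using Relation.ReflTransGen.head_induction_on with
  | refl => exact ho
  | @head a c hac _ ih =>
    have h := hinv c
    rw [ih] at h
    have := congrFun ((hasSum_zero_iff_of_nonneg fun x => mul_nonneg (hv x) (hP0 _ _)).1 h) a
    exact (mul_eq_zero.1 this).resolve_right hac.ne'

/-- A stochastic matrix with a state `o` that can be reached from every state has at most one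
invariant vector of total mass one. -/
theorem invariant_unique_of_reaches {E : Type*} {P : E → E → ℝ} (hP0 : ∀ x y, 0 ≤ P x y)
    (hP1 : ∀ x, HasSum (P x) 1) (o : E)
    (ho : ∀ x, Relation.ReflTransGen (fun x y => 0 < P x y) x o) {v w : E → ℝ}
    (hv1 : HasSum v 1) (hw1 : HasSum w 1) (hv : ∀ y, HasSum (fun x => v x * P x y) (v y))
    (hw : ∀ y, HasSum (fun x => w x * P x y) (w y)) : v = w := by
  wlog hvw : w o ≤ v o generalizing v w
  · exact (this hw1 hv1 hw hv (le_of_not_ge hvw)).symm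
  have hd1 : HasSum (fun x => v x - w x) 0 := by simpa using hv1.sub hw1
  have hd : ∀ y, HasSum (fun x => (v x - w x) * P x y) (v y - w y) := fun y => by
    simpa [sub_mul] using (hv y).sub (hw y)
  have habs := hasSum_abs_mul_of_invariant hP0 hP1 hd1.summable hd
  -- The negative part of `v - w` vanishes at `o`, hence everywhere.
  have hneg : ∀ x, |v x - w x| - (v x - w x) = 0 := fun x =>
    eq_zero_of_invariant_of_reaches hP0 (v := fun x => |v x - w x| - (v x - w x))
      (fun x => sub_nonneg.2 (le_abs_self _))
      (fun y => by simpa [sub_mul] using (habs y).sub (hd y))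
      (by simp [abs_of_nonneg (sub_nonneg.2 hvw)]) (ho x)
  have h0 : ∀ x, 0 ≤ v x - w x := fun x => abs_eq_self.1 (sub_eq_zero.1 (hneg x))
  funext x
  exact sub_eq_zero.1 (congrFun ((hasSum_zero_iff_of_nonneg h0).1 hd1) x)

/-! ### Probability mass functions -/

theorem hasSum_of_eq {ι : Type*} {f g : ι → ℝ} {a b : ℝ} (h : HasSum f a) (hfg : ∀ x, g x = f x)
    (hab : b = a) : HasSum g b := by
  rw [hab, funext hfg]; exact h

theorem map_apply_of_iff {α β : Type*} (q : PMF α) {f : α → β} {x : α} {y : β}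
    (h : ∀ a, y = f a ↔ a = x) : q.map f y = q x := by
  classical
  simp [PMF.map_apply, h]

theorem hasSum_toReal (q : PMF ℕ) : HasSum (fun x => (q x).toReal) 1 := by
  have h := ENNReal.hasSum_toReal q.tsum_coe_ne_top
  rwa [← ENNReal.tsum_toReal_eq q.apply_ne_top, q.tsum_coe] at h

theorem hasSum_toReal_bind {α β : Type*} (q : PMF α) (K : α → PMF β) (y : β) :
    HasSum (fun x => (q x).toReal * (K x y).toReal) (q.bind K y).toReal := by
  have h : ∑' x, q x * K x y ≠ ⊤ := by
    rw [← PMF.bind_apply]; exact PMF.apply_ne_top _ _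
  have h2 := ENNReal.hasSum_toReal h
  rw [← ENNReal.tsum_toReal_eq (ENNReal.ne_top_of_tsum_ne_top h)] at h2
  simpa only [PMF.bind_apply, ENNReal.toReal_mul] using h2

/-- A law on `ℕ` is determined by its masses at positive integers. -/
theorem pmf_ext_succ {q q' : PMF ℕ} (h : ∀ m, q (m + 1) = q' (m + 1)) : q = q' := by
  have hz : ∀ r : PMF ℕ, r 0 + ∑' m, r (m + 1) = 1 := fun r => by
    rw [← tsum_eq_zero_add' ENNReal.summable, r.tsum_coe]
  have hfin : ∑' m, q (m + 1) ≠ ⊤ :=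
    ne_top_of_le_ne_top ENNReal.one_ne_top ((hz q) ▸ le_add_self)
  refine PMF.ext fun m => ?_
  cases m with
  | succ m => exact h m
  | zero =>
    have h1 := (hz q).trans (hz q').symm
    rw [← tsum_congr h] at h1
    exact (ENNReal.add_left_inj hfin).1 h1

/-! ### Modified geometric laws and their evolution -/

/-- The modified geometric law with ratio `σ` and weight `α`: mass `α (1 - σ) σ ^ (m - 1)` at
`m > 0`, and the remaining mass `1 - α` at `0`. -/
def modGeom (σ α : ℝ) (m : ℕ) : ℝ :=
  if m = 0 then 1 - α else α * (1 - σ) * σ ^ (m - 1)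

theorem modGeom_nonneg {σ α : ℝ} (hσ : σ ∈ Set.Ico (0 : ℝ) 1) (hα : α ∈ Set.Icc (0 : ℝ) 1)
    (m : ℕ) : 0 ≤ modGeom σ α m := by
  have h1 := hσ.1
  have h2 := sub_nonneg.2 hσ.2.le
  have h3 := hα.1
  have h4 := sub_nonneg.2 hα.2
  unfold modGeom
  split_ifs <;> positivity

theorem hasSum_modGeom {σ : ℝ} (hσ : σ ∈ Set.Ico (0 : ℝ) 1) (α : ℝ) :
    HasSum (modGeom σ α) 1 := by
  have h : HasSum (fun m : ℕ => α * (1 - σ) * σ ^ m) α := by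
    have := (hasSum_geometric_of_lt_one hσ.1 hσ.2).mul_left (α * (1 - σ))
    rwa [mul_assoc, mul_inv_cancel₀ (sub_pos.2 hσ.2).ne', mul_one] at this
  rw [← hasSum_nat_add_iff' 1]
  simpa [modGeom] using h

/-- The modified geometric law as a probability mass function. -/
def modGeomPMF (σ α : ℝ) (hσ : σ ∈ Set.Ico (0 : ℝ) 1) (hα : α ∈ Set.Icc (0 : ℝ) 1) : PMF ℕ :=
  ⟨fun m => ENNReal.ofReal (modGeom σ α m), by
    have h := hasSum_modGeom hσ α
    rw [← ENNReal.ofReal_one, ← h.tsum_eq,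
      ENNReal.ofReal_tsum_of_nonneg (modGeom_nonneg hσ hα) h.summable]
    exact ENNReal.summable.hasSum⟩

theorem modGeomPMF_apply (σ α : ℝ) (hσ : σ ∈ Set.Ico (0 : ℝ) 1) (hα : α ∈ Set.Icc (0 : ℝ) 1)
    (m : ℕ) : modGeomPMF σ α hσ hα m = ENNReal.ofReal (modGeom σ α m) := rfl

theorem toReal_modGeomPMF (σ α : ℝ) (hσ : σ ∈ Set.Ico (0 : ℝ) 1) (hα : α ∈ Set.Icc (0 : ℝ) 1)
    (m : ℕ) : (modGeomPMF σ α hσ hα m).toReal = modGeom σ α m :=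
  ENNReal.toReal_ofReal (modGeom_nonneg hσ hα m)

theorem modGeom_affine (σ α : ℝ) (m : ℕ) :
    modGeom σ α m = modGeom σ 0 m + α * (modGeom σ 1 m - modGeom σ 0 m) := by
  unfold modGeom
  split_ifs <;> ring

theorem modGeomPMF_congr {σ α β : ℝ} (h : α = β) (hσ : σ ∈ Set.Ico (0 : ℝ) 1)
    (hα : α ∈ Set.Icc (0 : ℝ) 1) (hβ : β ∈ Set.Icc (0 : ℝ) 1) :
    modGeomPMF σ α hσ hα = modGeomPMF σ β hσ hβ := by
  subst h; rfl

theorem mul_pow_mem_Icc {α x : ℝ} (hα : α ∈ Set.Icc (0 : ℝ) 1) (hx : x ∈ Set.Icc (0 : ℝ) 1)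
    (n : ℕ) : α * x ^ n ∈ Set.Icc (0 : ℝ) 1 :=
  ⟨mul_nonneg hα.1 (pow_nonneg hx.1 n), mul_le_one₀ hα.2 (pow_nonneg hx.1 n)
    (pow_le_one₀ hx.1 hx.2)⟩

/-- A mixture of modified geometric laws with the same ratio is modified geometric, and its weight
is the mixture of the weights, because the masses are affine functions of the weight. -/
theorem bind_modGeomPMF {σ β : ℝ} (hσ : σ ∈ Set.Ico (0 : ℝ) 1) (w : PMF ℕ) {f : ℕ → ℝ}
    (hf : ∀ j, f j ∈ Set.Icc (0 : ℝ) 1) (hβ : β ∈ Set.Icc (0 : ℝ) 1)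
    (h : HasSum (fun j => (w j).toReal * f j) β) :
    w.bind (fun j => modGeomPMF σ (f j) hσ (hf j)) = modGeomPMF σ β hσ hβ := by
  refine PMF.ext fun m => (ENNReal.toReal_eq_toReal_iff' (PMF.apply_ne_top _ _)
    (PMF.apply_ne_top _ _)).1 ?_
  refine (hasSum_toReal_bind w _ m).unique ?_
  simp only [toReal_modGeomPMF]
  refine hasSum_of_eq (((hasSum_toReal w).mul_right (modGeom σ 0 m)).add
    (h.mul_right (modGeom σ 1 m - modGeom σ 0 m))) (fun j => ?_) ?_
  · rw [modGeom_affine σ (f j)]; ring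
  · rw [modGeom_affine σ β]; ring

theorem map_sub_modGeomPMF {σ α : ℝ} (hσ : σ ∈ Set.Ico (0 : ℝ) 1) (hα : α ∈ Set.Icc (0 : ℝ) 1)
    (j : ℕ) : (modGeomPMF σ α hσ hα).map (fun m => m - j) =
      modGeomPMF σ (α * σ ^ j) hσ (mul_pow_mem_Icc hα (Set.Ico_subset_Icc_self hσ) j) := by
  refine pmf_ext_succ fun m => ?_
  rw [map_apply_of_iff (x := m + 1 + j) _ (by omega), modGeomPMF_apply, modGeomPMF_apply]
  congr 1
  simp only [modGeom, Nat.add_sub_cancel, if_neg (Nat.succ_ne_zero m),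
    show m + 1 + j ≠ 0 by omega, if_false, show m + 1 + j - 1 = m + j by omega]
  ring

theorem map_succ_modGeomPMF {σ : ℝ} (hσ : σ ∈ Set.Ico (0 : ℝ) 1) :
    (modGeomPMF σ σ hσ (Set.Ico_subset_Icc_self hσ)).map Nat.succ =
      modGeomPMF σ 1 hσ (Set.right_mem_Icc.2 zero_le_one) := by
  refine pmf_ext_succ fun m => ?_
  rw [map_apply_of_iff (x := m) _ (by omega), modGeomPMF_apply, modGeomPMF_apply]
  congr 1
  cases m with
  | zero => simp [modGeom]
  | succ m => simp [modGeom, pow_succ]; ring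

section

variable {p : PMF ℕ} {b : ℕ}

theorem hasSum_batchPGF (hp : p.support ⊆ Set.Icc 1 b) (x : ℝ) :
    HasSum (fun j => (p j).toReal * x ^ j) (batchPGF p b x) := by
  refine hasSum_sum_of_ne_finset_zero fun j hj => ?_
  have h0 : p j = 0 := (p.apply_eq_zero_iff j).2 fun h => hj (Finset.mem_Icc.2 (hp h))
  simp [h0]

theorem batchPGF_one (hp : p.support ⊆ Set.Icc 1 b) : batchPGF p b 1 = 1 :=
  (hasSum_batchPGF hp 1).unique (by simpa using hasSum_toReal p)

theorem batchPGF_mem_Icc (hp : p.support ⊆ Set.Icc 1 b) {x : ℝ} (hx : x ∈ Set.Icc (0 : ℝ) 1) :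
    batchPGF p b x ∈ Set.Icc (0 : ℝ) 1 := by
  refine ⟨Finset.sum_nonneg fun j _ => mul_nonneg ENNReal.toReal_nonneg (pow_nonneg hx.1 j), ?_⟩
  rw [← batchPGF_one hp]
  exact Finset.sum_le_sum fun j _ => mul_le_mul_of_nonneg_left
    (pow_le_pow_left₀ hx.1 hx.2 j) ENNReal.toReal_nonneg

/-- A service completion multiplies the weight of a modified geometric law by `φ_Y(σ)`. -/
theorem modGeomPMF_bind_serviceStep (hp : p.support ⊆ Set.Icc 1 b) {σ α : ℝ}
    (hσ : σ ∈ Set.Ico (0 : ℝ) 1) (hα : α ∈ Set.Icc (0 : ℝ) 1)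
    (hβ : α * batchPGF p b σ ∈ Set.Icc (0 : ℝ) 1) :
    (modGeomPMF σ α hσ hα).bind (serviceStep p) =
      modGeomPMF σ (α * batchPGF p b σ) hσ hβ := by
  have h : (modGeomPMF σ α hσ hα).bind (serviceStep p) =
      p.bind fun j => (modGeomPMF σ α hσ hα).map (fun m => m - j) :=
    PMF.bind_comm _ _ fun m j => PMF.pure (m - j)
  simp only [h, map_sub_modGeomPMF]
  refine bind_modGeomPMF hσ p _ _ ?_
  exact hasSum_of_eq ((hasSum_batchPGF hp σ).mul_left α) (fun j => by ring) rfl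

theorem bind_iterate_pure (q : PMF ℕ) (n : ℕ) :
    q.bind (fun m => (fun q : PMF ℕ => q.bind (serviceStep p))^[n] (PMF.pure m)) =
      (fun q : PMF ℕ => q.bind (serviceStep p))^[n] q := by
  induction n with
  | zero => exact q.bind_pure
  | succ n ih => simp only [Function.iterate_succ_apply', ← ih, PMF.bind_bind]

theorem iterate_serviceStep_modGeomPMF (hp : p.support ⊆ Set.Icc 1 b) {σ α : ℝ}
    (hσ : σ ∈ Set.Ico (0 : ℝ) 1) (hα : α ∈ Set.Icc (0 : ℝ) 1) (n : ℕ) :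
    (fun q : PMF ℕ => q.bind (serviceStep p))^[n] (modGeomPMF σ α hσ hα) =
      modGeomPMF σ (α * batchPGF p b σ ^ n) hσ
        (mul_pow_mem_Icc hα (batchPGF_mem_Icc hp (Set.Ico_subset_Icc_self hσ)) n) := by
  have hφ := batchPGF_mem_Icc hp (Set.Ico_subset_Icc_self hσ)
  induction n with
  | zero => exact modGeomPMF_congr (by simp) _ _ _
  | succ n ih =>
    have h := mul_pow_mem_Icc (mul_pow_mem_Icc hα hφ n) hφ 1
    rw [pow_one] at h
    rw [Function.iterate_succ_apply', ih, modGeomPMF_bind_serviceStep hp hσ _ h]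
    exact modGeomPMF_congr (by ring) _ _ _

theorem toReal_poisson (r : NNReal) (n : ℕ) :
    ((poissonMeasure r).toPMF n).toReal = Real.exp (-r) * r ^ n / n.factorial := by
  rw [Measure.toPMF_apply, ← Measure.real, poissonMeasure_real_singleton]

theorem hasSum_poisson_mul_pow (r : NNReal) (x : ℝ) :
    HasSum (fun n => ((poissonMeasure r).toPMF n).toReal * x ^ n) (Real.exp (-(r * (1 - x)))) := by
  have h := (NormedSpace.expSeries_div_hasSum_exp (r * x : ℝ)).mul_left (Real.exp (-r))
  rw [← Real.exp_eq_exp_ℝ, ← Real.exp_add] at h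
  refine hasSum_of_eq h (fun n => ?_) ?_
  · rw [toReal_poisson, mul_pow]; ring
  · ring_nf

theorem exp_neg_mul_mem_Icc {a t : ℝ} (ha : 0 ≤ a) (ht : 0 ≤ t) :
    Real.exp (-(a * t)) ∈ Set.Icc (0 : ℝ) 1 :=
  ⟨(Real.exp_pos _).le, Real.exp_le_one_iff.2 (neg_nonpos.2 (mul_nonneg ha ht))⟩

/-- Serving for a time `t` multiplies the weight of a modified geometric law by
`exp (-μ (1 - φ_Y(σ)) t)`, the mean of `φ_Y(σ) ^ N` for a Poisson variable `N`. -/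
theorem modGeomPMF_bind_serve (hp : p.support ⊆ Set.Icc 1 b) {σ α β mu t : ℝ} (hmu : 0 ≤ mu)
    (ht : 0 ≤ t) (hσ : σ ∈ Set.Ico (0 : ℝ) 1) (hα : α ∈ Set.Icc (0 : ℝ) 1)
    (hβ : β ∈ Set.Icc (0 : ℝ) 1) (h : β = α * Real.exp (-(mu * (1 - batchPGF p b σ) * t))) :
    (modGeomPMF σ α hσ hα).bind (serve mu p t) = modGeomPMF σ β hσ hβ := by
  have h1 : (modGeomPMF σ α hσ hα).bind (serve mu p t) =
      (poissonMeasure (mu * t).toNNReal).toPMF.bind fun n =>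
        (modGeomPMF σ α hσ hα).bind
          (fun m => (fun q : PMF ℕ => q.bind (serviceStep p))^[n] (PMF.pure m)) :=
    PMF.bind_comm _ _ fun m n => (fun q : PMF ℕ => q.bind (serviceStep p))^[n] (PMF.pure m)
  simp only [h1, bind_iterate_pure, iterate_serviceStep_modGeomPMF hp]
  refine bind_modGeomPMF hσ _ _ _ ?_
  have h2 := (hasSum_poisson_mul_pow (mu * t).toNNReal (batchPGF p b σ)).mul_left α
  rw [Real.coe_toNNReal _ (mul_nonneg hmu ht)] at h2
  refine hasSum_of_eq h2 (fun n => by ring) ?_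
  rw [h]; ring_nf

end

/-! ### The fixed-point equations for the ratios -/

/-- A function on `[0, 1]` that is positive at `0` and fixes `1` with slope larger than `1` has a
fixed point in `(0, 1)`; the least one is the least point where the function is below the
diagonal. -/
theorem exists_least_fixedPoint {f : ℝ → ℝ} {d : ℝ} (hf : ContinuousOn f (Set.Icc 0 1))
    (h0 : 0 < f 0) (h1 : f 1 = 1) (hd : HasDerivAt f d 1) (hd1 : 1 < d) :
    ∃ x ∈ Set.Ioo (0 : ℝ) 1, f x = x ∧ ∀ y ∈ Set.Icc (0 : ℝ) 1, f y ≤ y → x ≤ y := by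
  have hbelow : ∃ y ∈ Set.Ioo (0 : ℝ) 1, f y < y := by
    have hs := (hasDerivAt_iff_tendsto_slope.1 hd).mono_left
      (nhdsWithin_mono 1 (show Set.Iio (1 : ℝ) ⊆ {1}ᶜ from fun y hy => ne_of_lt hy))
    have he := (hs.eventually_const_lt hd1).and
      (Ioo_mem_nhdsLT (zero_lt_one : (0 : ℝ) < 1))
    obtain ⟨y, hy, hy01⟩ := he.exists
    refine ⟨y, hy01, ?_⟩
    rw [slope_def_field, h1, lt_div_iff_of_neg (sub_neg.2 hy01.2)] at hy
    linarith
  have hclosed : IsClosed {y ∈ Set.Icc (0 : ℝ) 1 | f y ≤ y} :=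
    isClosed_Icc.isClosed_le hf continuousOn_id
  obtain ⟨x, ⟨hx01, hfx⟩, hleast⟩ := (isCompact_Icc.of_isClosed_subset hclosed
    (Set.sep_subset _ _)).exists_isLeast
      (by obtain ⟨y, hy, hfy⟩ := hbelow; exact ⟨y, Set.Ioo_subset_Icc_self hy, hfy.le⟩)
  have hx1 : x < 1 := by
    obtain ⟨y, hy, hfy⟩ := hbelow
    exact (hleast ⟨Set.Ioo_subset_Icc_self hy, hfy.le⟩).trans_lt hy.2
  have hx0 : 0 < x := hx01.1.lt_of_ne fun h => by
    rw [← h] at hfx; exact absurd h0 hfx.not_gt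
  refine ⟨x, ⟨hx0, hx1⟩, ?_, fun y hy hfy => hleast ⟨hy, hfy⟩⟩
  have hsub : Set.Icc 0 x ⊆ Set.Icc (0 : ℝ) 1 := Set.Icc_subset_Icc_right hx01.2
  obtain ⟨y, hy, hfy⟩ := intermediate_value_Icc' (f := fun y => f y - y) hx0.le
    ((hf.mono hsub).sub continuousOn_id) (show (0 : ℝ) ∈ _ from
      ⟨sub_nonpos.2 hfx, by simpa using h0.le⟩)
  have hxy : x = y := le_antisymm (hleast ⟨hsub hy, (sub_eq_zero.1 hfy).le⟩) hy.2
  rw [hxy]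
  exact sub_eq_zero.1 hfy

section

variable {p : PMF ℕ} {b : ℕ} {ρ : ℝ}

theorem continuous_batchPGF : Continuous (batchPGF p b) :=
  continuous_finsetSum _ fun j _ => continuous_const.mul (continuous_pow j)

theorem hasDerivAt_batchPGF_one : HasDerivAt (batchPGF p b) (batchMean p b) 1 := by
  have h : ∀ j ∈ Finset.Icc 1 b, HasDerivAt (fun x : ℝ => (p j).toReal * x ^ j)
      ((j : ℝ) * (p j).toReal) 1 := fun j _ => by
    simpa [mul_comm] using (hasDerivAt_pow j (1 : ℝ)).const_mul (p j).toReal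
  exact HasDerivAt.fun_sum h

theorem convexOn_batchPGF : ConvexOn ℝ (Set.Ioi 0) (batchPGF p b) := by
  have h : ∀ s : Finset ℕ, ConvexOn ℝ (Set.Ioi (0 : ℝ))
      fun x : ℝ => ∑ j ∈ s, (p j).toReal * x ^ j := by
    intro s
    induction s using Finset.cons_induction with
    | empty => simpa using convexOn_const 0 (convex_Ioi 0)
    | cons j s hj ih =>
      simp only [Finset.sum_cons]
      exact (((convexOn_pow j).subset Set.Ioi_subset_Ici_self (convex_Ioi 0)).smul
        ENNReal.toReal_nonneg).add ih
  exact h _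

theorem batchPGF_lt_one (hp : p.support ⊆ Set.Icc 1 b) {x : ℝ} (hx : x ∈ Set.Ico (0 : ℝ) 1) :
    batchPGF p b x < 1 := by
  obtain ⟨j, hj⟩ := p.support_nonempty
  rw [← batchPGF_one hp]
  refine Finset.sum_lt_sum (fun i _ => mul_le_mul_of_nonneg_left
    (pow_le_pow_left₀ hx.1 hx.2.le i) ENNReal.toReal_nonneg) ⟨j, Finset.mem_Icc.2 (hp hj), ?_⟩
  exact mul_lt_mul_of_pos_left
    (pow_lt_pow_left₀ hx.2 hx.1 (Nat.one_le_iff_ne_zero.1 (hp hj).1))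
    (ENNReal.toReal_pos hj (p.apply_ne_top j))

/-- The equation `σ = exp (-(1 - φ_Y(σ)) / ρ)` has exactly one root below `1`: it says that the
strictly concave function `log σ + (1 - φ_Y(σ)) / ρ`, which also vanishes at `1`, is zero. -/
theorem exists_root (hp : p.support ⊆ Set.Icc 1 b) (hρ : 0 < ρ) (herg : ρ < batchMean p b) :
    ∃ σ ∈ Set.Ioo (0 : ℝ) 1, σ = Real.exp (-(1 - batchPGF p b σ) / ρ) ∧
      (∀ x : ℝ, x < 1 → x = Real.exp (-(1 - batchPGF p b x) / ρ) → x = σ) ∧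
      (∀ x ∈ Set.Icc (0 : ℝ) 1, Real.exp (-(1 - batchPGF p b x) / ρ) ≤ x → σ ≤ x) ∧
      ∀ x ∈ Set.Ioo σ 1, Real.exp (-(1 - batchPGF p b x) / ρ) < x := by
  have hderiv : HasDerivAt (fun x => Real.exp (-(1 - batchPGF p b x) / ρ))
      (batchMean p b / ρ) 1 := by
    have h := (((hasDerivAt_batchPGF_one (p := p) (b := b)).const_sub 1).neg.div_const ρ).exp
    simpa [batchPGF_one hp] using h
  obtain ⟨σ, hσ, hfix, hleast⟩ := exists_least_fixedPoint
    (f := fun x => Real.exp (-(1 - batchPGF p b x) / ρ))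
    (Real.continuous_exp.comp
      ((continuous_const.sub continuous_batchPGF).neg.div_const ρ)).continuousOn
    (Real.exp_pos _) (by simp [batchPGF_one hp]) hderiv ((one_lt_div hρ).2 herg)
  set L : ℝ → ℝ := fun x => Real.log x + (batchPGF p b x * (-ρ⁻¹) + ρ⁻¹) with hL
  have hconc : StrictConcaveOn ℝ (Set.Ioi 0) L := by
    refine strictConcaveOn_log_Ioi.add_concaveOn ?_
    have h : ConvexOn ℝ (Set.Ioi 0) fun x => ρ⁻¹ • batchPGF p b x :=
      convexOn_batchPGF.smul (inv_pos.2 hρ).le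
    refine (h.neg.add_const ρ⁻¹).congr fun x _ => ?_
    simp only [Pi.add_apply, Pi.neg_apply, smul_eq_mul]; ring
  have hL' : ∀ x, L x = Real.log x - (-(1 - batchPGF p b x) / ρ) := fun x => by
    simp only [hL]; field_simp; ring
  have hzero : ∀ x, 0 < x → x = Real.exp (-(1 - batchPGF p b x) / ρ) → L x = 0 := by
    intro x hx h
    rw [hL', sub_eq_zero]
    conv_lhs => rw [h]
    exact Real.log_exp _
  have h1 : L 1 = 0 := by simp [hL', batchPGF_one hp]
  -- `L` is positive between two of its zeros.
  have hpos : ∀ x y, 0 < x → L x = 0 → y ∈ Set.Ioo x 1 → 0 < L y := by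
    intro x y hx h hy
    have hx1 := hy.1.trans hy.2
    have := hconc.lt_on_openSegment (x := x) (y := 1) (z := y) hx (Set.mem_Ioi.2 one_pos) hx1.ne
      (by rwa [openSegment_eq_Ioo hx1])
    simpa [h, h1] using this
  refine ⟨σ, hσ, hfix.symm, fun x hx1 hx => ?_, hleast, fun x hx => ?_⟩
  · have hx0 : 0 < x := by rw [hx]; exact Real.exp_pos _
    rcases lt_trichotomy x σ with h | h | h
    · exact absurd (hzero σ hσ.1 hfix.symm) (hpos x σ hx0 (hzero x hx0 hx) ⟨h, hσ.2⟩).ne'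
    · exact h
    · exact absurd (hzero x hx0 hx) (hpos σ x hσ.1 (hzero σ hσ.1 hfix.symm) ⟨h, hx1⟩).ne'
  · have h := hpos σ x hσ.1 (hzero σ hσ.1 hfix.symm) hx
    rw [hL', sub_pos] at h
    exact (Real.lt_log_iff_exp_lt (hσ.1.trans hx.1)).1 h

/-- The Laplace transform of an exponential phase with mean `1 / (k lam)`, at
`s = mu (1 - φ_Y(x))`, with `ρ = lam / mu`. Its `k`-th power belongs to the Erlang law. -/
def phaseFactor (p : PMF ℕ) (b : ℕ) (ρ : ℝ) (k : ℕ) (x : ℝ) : ℝ :=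
  (1 + (1 - batchPGF p b x) / ρ / k)⁻¹

theorem one_le_phaseFactor_inv (hp : p.support ⊆ Set.Icc 1 b) (hρ : 0 < ρ) (k : ℕ) {x : ℝ}
    (hx : x ∈ Set.Icc (0 : ℝ) 1) : 1 ≤ 1 + (1 - batchPGF p b x) / ρ / k :=
  le_add_of_nonneg_right (div_nonneg (div_nonneg (sub_nonneg.2 (batchPGF_mem_Icc hp hx).2) hρ.le)
    k.cast_nonneg)

theorem phaseFactor_mem_Icc (hp : p.support ⊆ Set.Icc 1 b) (hρ : 0 < ρ) (k : ℕ) {x : ℝ}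
    (hx : x ∈ Set.Icc (0 : ℝ) 1) : phaseFactor p b ρ k x ∈ Set.Icc (0 : ℝ) 1 :=
  ⟨inv_nonneg.2 (zero_le_one.trans (one_le_phaseFactor_inv hp hρ k hx)),
    inv_le_one_of_one_le₀ (one_le_phaseFactor_inv hp hρ k hx)⟩

theorem exists_phase_root (hp : p.support ⊆ Set.Icc 1 b) (hρ : 0 < ρ) (herg : ρ < batchMean p b)
    {k : ℕ} (hk : 1 ≤ k) :
    ∃ x ∈ Set.Ioo (0 : ℝ) 1, phaseFactor p b ρ k x ^ k = x ∧
      ∀ y ∈ Set.Icc (0 : ℝ) 1, phaseFactor p b ρ k y ^ k ≤ y → x ≤ y := by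
  have hk0 : (k : ℝ) ≠ 0 := Nat.cast_ne_zero.2 (by omega)
  have hne : ∀ x ∈ Set.Icc (0 : ℝ) 1, 1 + (1 - batchPGF p b x) / ρ / k ≠ 0 := fun x hx =>
    (one_pos.trans_le (one_le_phaseFactor_inv hp hρ k hx)).ne'
  have hderiv : HasDerivAt (fun x => phaseFactor p b ρ k x ^ k) (batchMean p b / ρ) 1 := by
    have h := ((((((hasDerivAt_batchPGF_one (p := p) (b := b)).const_sub 1).div_const ρ).div_const
      (k : ℝ)).const_add 1).fun_inv (hne 1 (Set.right_mem_Icc.2 zero_le_one))).fun_pow k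
    refine h.congr_deriv ?_
    rw [batchPGF_one hp]
    simp only [sub_self, zero_div, add_zero, inv_one, one_pow, mul_one, div_one, neg_neg, neg_div]
    exact mul_div_cancel₀ _ hk0
  refine exists_least_fixedPoint ?_ ?_ ?_ hderiv ((one_lt_div hρ).2 herg)
  · refine ContinuousOn.pow (ContinuousOn.inv₀ ?_ hne) k
    exact (continuous_const.add
      (((continuous_const.sub continuous_batchPGF).div_const ρ).div_const _)).continuousOn
  · have h := one_le_phaseFactor_inv hp hρ k (Set.left_mem_Icc.2 zero_le_one)
    exact pow_pos (inv_pos.2 (one_pos.trans_le h)) k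
  · simp [phaseFactor, batchPGF_one hp]

/-- The ratios of the Erlang queues converge to the ratio of the deterministic queue. The Laplace
transform of the Erlang law decreases to the one of the point mass, which bounds the ratios from
below by `σ`; they are eventually below each `x ∈ (σ, 1)` because such an `x` is eventually above
the value of the transform, and the ratios are least with this property. -/
theorem tendsto_phase_root (hp : p.support ⊆ Set.Icc 1 b) (hρ : 0 < ρ) {σ : ℝ}
    (hσ : σ ∈ Set.Ioo (0 : ℝ) 1)
    (hleast : ∀ x ∈ Set.Icc (0 : ℝ) 1, Real.exp (-(1 - batchPGF p b x) / ρ) ≤ x → σ ≤ x)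
    (hbelow : ∀ x ∈ Set.Ioo σ 1, Real.exp (-(1 - batchPGF p b x) / ρ) < x) {s : ℕ → ℝ}
    (hs : ∀ k, 1 ≤ k → s k ∈ Set.Ioo (0 : ℝ) 1 ∧ phaseFactor p b ρ k (s k) ^ k = s k ∧
      ∀ y ∈ Set.Icc (0 : ℝ) 1, phaseFactor p b ρ k y ^ k ≤ y → s k ≤ y) :
    Tendsto s atTop (𝓝 σ) := by
  have hlower : ∀ᶠ k in atTop, σ ≤ s k := by
    filter_upwards [eventually_ge_atTop 1] with k hk
    obtain ⟨hsk, hfix, -⟩ := hs k hk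
    refine hleast _ (Set.Ioo_subset_Icc_self hsk) (le_trans ?_ hfix.le)
    have hk0 : (0 : ℝ) < k := Nat.cast_pos.2 hk
    set a := (1 - batchPGF p b (s k)) / ρ with ha
    have h1 : 1 ≤ 1 + a / k := one_le_phaseFactor_inv hp hρ k (Set.Ioo_subset_Icc_self hsk)
    have h2 : (1 + a / k) ^ k ≤ Real.exp a := by
      have h3 : 1 + a / k ≤ Real.exp (a / k) := by
        rw [add_comm]; exact Real.add_one_le_exp _
      refine (pow_le_pow_left₀ (zero_le_one.trans h1) h3 k).trans_eq ?_
      rw [← Real.exp_nat_mul, mul_div_cancel₀ _ hk0.ne']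
    rw [neg_div, ← ha, Real.exp_neg, phaseFactor, ← ha, inv_pow]
    exact inv_anti₀ (pow_pos (one_pos.trans_le h1) k) h2
  refine tendsto_order.2 ⟨fun a ha => hlower.mono fun k hk => ha.trans_le hk, fun a ha => ?_⟩
  obtain ⟨x, hσx, hx⟩ := exists_between (lt_min ha hσ.2)
  have hx1 : x < 1 := hx.trans_le (min_le_right _ _)
  have hx01 : x ∈ Set.Icc (0 : ℝ) 1 := ⟨hσ.1.le.trans hσx.le, hx1.le⟩
  have hlim : Tendsto (fun k : ℕ => phaseFactor p b ρ k x ^ k) atTop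
      (𝓝 (Real.exp (-(1 - batchPGF p b x) / ρ))) := by
    rw [neg_div, Real.exp_neg]
    simp only [phaseFactor, inv_pow]
    exact (Real.tendsto_one_add_div_pow_exp _).inv₀ (Real.exp_ne_zero _)
  filter_upwards [eventually_ge_atTop 1, hlim.eventually_lt_const (hbelow x ⟨hσx, hx1⟩)]
    with k hk hlt
  exact ((hs k hk).2.2 x hx01 hlt.le).trans_lt (hx.trans_le (min_le_left _ _))

end

/-! ### The queue with Erlang inter-arrival times -/

section

variable {p : PMF ℕ} {b k : ℕ} {lam mu : ℝ}

theorem serviceStep_zero (p : PMF ℕ) : serviceStep p 0 = PMF.pure 0 := by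
  rw [serviceStep, show (fun j : ℕ => 0 - j) = Function.const ℕ 0 from funext Nat.zero_sub,
    PMF.map_const]

theorem serviceStep_self (hp : p.support ⊆ Set.Icc 1 b) {m : ℕ} (hm : 0 < m) :
    serviceStep p m m = 0 := by
  rw [PMF.apply_eq_zero_iff, serviceStep, PMF.mem_support_map_iff]
  rintro ⟨j, hj, h⟩
  have := (hp hj).1
  omega

/-- The state reached at the end of the current arrival phase. -/
def nextPhase (x : ℕ × Fin k) : ℕ × Fin k :=
  if h : (x.2 : ℕ) + 1 < k then (x.1, ⟨x.2 + 1, h⟩) else (x.1 + 1, ⟨0, x.2.pos⟩)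

theorem nextPhase_eq_iff (x y : ℕ × Fin k) :
    y = nextPhase x ↔ if (x.2 : ℕ) + 1 < k then y.1 = x.1 ∧ (y.2 : ℕ) = (x.2 : ℕ) + 1
      else y.1 = x.1 + 1 ∧ (y.2 : ℕ) = 0 := by
  unfold nextPhase
  split_ifs <;> simp [Prod.ext_iff, Fin.ext_iff]

/-- The transition matrix of the chain observed at the epochs of a Poisson process of rate
`lam + mu`, at each of which either an arrival phase or a service ends; a service that ends in an
empty system changes nothing. -/
def erlangMatrix (lam mu : ℝ) (p : PMF ℕ) (k : ℕ) (x y : ℕ × Fin k) : ℝ :=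
  (lam * (if y = nextPhase x then 1 else 0) +
    mu * (if y.2 = x.2 then (serviceStep p x.1 y.1).toReal else 0)) / (lam + mu)

/-- Uniformization of the chain. -/
theorem erlangGenerator_eq (hp : p.support ⊆ Set.Icc 1 b) (hlam : 0 < lam) (hmu : 0 < mu)
    (x y : ℕ × Fin k) : erlangGenerator lam mu p k x y =
      (lam + mu) * (erlangMatrix lam mu p k x y - if x = y then 1 else 0) := by
  have hL : lam + mu ≠ 0 := (add_pos hlam hmu).ne'
  rw [erlangMatrix, mul_sub, mul_div_cancel₀ _ hL]
  by_cases hxy : x = y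
  · subst hxy
    have hne : x ≠ nextPhase x := fun h => by
      rw [nextPhase_eq_iff] at h
      split_ifs at h <;> omega
    rcases Nat.eq_zero_or_pos x.1 with h | h
    · simp [erlangGenerator, hne, h, serviceStep_zero]
    · simp [erlangGenerator, hne, h, serviceStep_self hp h]
  · have hphase : (if (x.2 : ℕ) + 1 < k then
        (if y.1 = x.1 ∧ (y.2 : ℕ) = (x.2 : ℕ) + 1 then lam else 0)
      else (if y.1 = x.1 + 1 ∧ (y.2 : ℕ) = 0 then lam else 0)) =
        lam * (if y = nextPhase x then 1 else 0) := by
      simp only [nextPhase_eq_iff]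
      split_ifs <;> simp_all
    rw [erlangGenerator, if_neg hxy, erlangRate, hphase, if_neg hxy, mul_zero, sub_zero]
    congr 1
    by_cases hy : y.2 = x.2
    · rcases Nat.eq_zero_or_pos x.1 with h | h
      · have hy1 : y.1 ≠ 0 := fun h1 => hxy (Prod.ext (h.trans h1.symm) hy.symm)
        simp [h, hy, serviceStep_zero, hy1]
      · simp [h, hy]
    · simp [hy]

theorem erlangMatrix_nonneg (hlam : 0 < lam) (hmu : 0 < mu) (x y : ℕ × Fin k) :
    0 ≤ erlangMatrix lam mu p k x y := by
  refine div_nonneg (add_nonneg (mul_nonneg hlam.le ?_) (mul_nonneg hmu.le ?_))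
    (add_pos hlam hmu).le
  · split_ifs <;> simp
  · split_ifs <;> simp

theorem hasSum_fiber {f : ℕ → ℝ} {a : ℝ} (h : HasSum f a) (i : Fin k) :
    HasSum (fun x : ℕ × Fin k => if x.2 = i then f x.1 else 0) a := by
  have hinj : Function.Injective fun m : ℕ => (m, i) := Prod.mk_left_injective i
  refine (hinj.hasSum_iff fun x hx => if_neg fun hi => hx ⟨x.1, ?_⟩).1 (by
    simpa [Function.comp_def] using h)
  rw [← hi]

theorem hasSum_erlangMatrix (hlam : 0 < lam) (hmu : 0 < mu) (x : ℕ × Fin k) :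
    HasSum (erlangMatrix lam mu p k x) 1 := by
  have h := (((hasSum_ite_eq (nextPhase x) (1 : ℝ)).mul_left lam).add
    ((hasSum_fiber (hasSum_toReal (serviceStep p x.1)) x.2).mul_left mu)).div_const (lam + mu)
  rwa [mul_one, mul_one, div_self (add_pos hlam hmu).ne'] at h

theorem hasSum_mul_generator_iff (hp : p.support ⊆ Set.Icc 1 b) (hlam : 0 < lam) (hmu : 0 < mu)
    (π : ℕ × Fin k → ℝ) (y : ℕ × Fin k) :
    HasSum (fun x => π x * erlangGenerator lam mu p k x y) 0 ↔
      HasSum (fun x => π x * erlangMatrix lam mu p k x y) (π y) := by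
  have hL : lam + mu ≠ 0 := (add_pos hlam hmu).ne'
  have hy : HasSum (fun x => π x * if x = y then 1 else 0) (π y) := by
    refine hasSum_of_eq (hasSum_ite_eq y (π y)) (fun x => ?_) rfl
    split_ifs with h <;> simp [h]
  constructor
  · intro h
    refine hasSum_of_eq ((h.div_const (lam + mu)).add hy) (fun x => ?_) (by simp)
    rw [erlangGenerator_eq hp hlam hmu]
    field_simp
    ring
  · intro h
    refine hasSum_of_eq ((h.sub hy).mul_left (lam + mu)) (fun x => ?_) (by simp)
    rw [erlangGenerator_eq hp hlam hmu]
    ring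

theorem erlangMatrix_reaches (hp : p.support ⊆ Set.Icc 1 b) (hlam : 0 < lam) (hmu : 0 < mu)
    (hk : 1 ≤ k) (x : ℕ × Fin k) :
    Relation.ReflTransGen (fun x y => 0 < erlangMatrix lam mu p k x y) x
      (0, ⟨k - 1, by omega⟩) := by
  obtain ⟨m, i⟩ := x
  have hL := add_pos hlam hmu
  induction m using Nat.strong_induction_on with
  | _ m ih =>
    rcases Nat.eq_zero_or_pos m with rfl | hm
    · -- In the empty system, arrival phases lead up to the last one.
      clear ih
      obtain ⟨n, hn⟩ : ∃ n, (i : ℕ) + n = k - 1 := ⟨k - 1 - i, by omega⟩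
      induction n generalizing i with
      | zero =>
        have : i = ⟨k - 1, by omega⟩ := Fin.ext hn
        rw [this]
      | succ n ihn =>
        refine Relation.ReflTransGen.head ?_ (ihn ⟨i + 1, by omega⟩ (by simp; omega))
        refine div_pos (add_pos_of_pos_of_nonneg ?_ ?_) hL
        · rw [if_pos ((nextPhase_eq_iff _ _).2 (by simp; omega)), mul_one]
          exact hlam
        · refine mul_nonneg hmu.le ?_
          split_ifs <;> simp
    · obtain ⟨j, hj⟩ := p.support_nonempty
      have hj1 := (hp hj).1
      refine Relation.ReflTransGen.head ?_ (ih (m - j) (by omega))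
      refine div_pos (add_pos_of_nonneg_of_pos ?_ ?_) hL
      · refine mul_nonneg hlam.le ?_
        split_ifs <;> simp
      · rw [if_pos rfl]
        refine mul_pos hmu (ENNReal.toReal_pos ?_ (PMF.apply_ne_top _ _))
        rw [← PMF.mem_support_iff, serviceStep, PMF.mem_support_map_iff]
        exact ⟨j, hj, rfl⟩

theorem IsErlangStationary.unique (hp : p.support ⊆ Set.Icc 1 b) (hlam : 0 < lam) (hmu : 0 < mu)
    (hk : 1 ≤ k) {π ν : ℕ × Fin k → ℝ} (hπ : IsErlangStationary lam mu p k π)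
    (hν : IsErlangStationary lam mu p k ν) : ν = π :=
  invariant_unique_of_reaches (erlangMatrix_nonneg hlam hmu) (hasSum_erlangMatrix hlam hmu) _
    (erlangMatrix_reaches hp hlam hmu hk) hν.2.1 hπ.2.1
    (fun y => (hasSum_mul_generator_iff hp hlam hmu ν y).1 (hν.2.2 y))
    (fun y => (hasSum_mul_generator_iff hp hlam hmu π y).1 (hπ.2.2 y))

/-- The stationary distribution of the queue with Erlang(`k`) inter-arrival times: the phase is
uniform, and given the phase `i` the number of customers is modified geometric with ratio `σ` and
weight `z ^ (i + 1)`, where `z` satisfies `z ^ k = σ`. -/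
def erlangStationary (k : ℕ) (σ z : ℝ) (x : ℕ × Fin k) : ℝ :=
  modGeom σ (z ^ ((x.2 : ℕ) + 1)) x.1 / k

/-- The end of an arrival phase takes the modified geometric law of phase `i - 1` to weight `z ^ i`
in phase `i`; for `i = 0` this is the arrival of a customer, which takes weight `σ = z ^ k` to
weight `1`. -/
theorem hasSum_erlangStationary_nextPhase {σ z : ℝ} (hz : z ^ k = σ) (y : ℕ × Fin k) :
    HasSum (fun x => erlangStationary k σ z x * if y = nextPhase x then 1 else 0)
      (modGeom σ (z ^ (y.2 : ℕ)) y.1 / k) := by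
  obtain ⟨m, i⟩ := y
  have hi := i.2
  rcases Nat.eq_zero_or_pos (i : ℕ) with h0 | h0
  · rcases Nat.eq_zero_or_pos m with rfl | hm
    · refine hasSum_of_eq hasSum_zero (fun x => ?_) (by simp [h0, modGeom])
      rw [if_neg, mul_zero]
      rw [nextPhase_eq_iff]
      split_ifs <;> simp; omega
    · have h := hasSum_ite_eq ((m - 1, ⟨k - 1, by omega⟩) : ℕ × Fin k)
        (modGeom σ (z ^ (i : ℕ)) m / k)
      refine hasSum_of_eq h (fun x => ?_) rfl
      have hiff : (m, i) = nextPhase x ↔ x = (m - 1, ⟨k - 1, by omega⟩) := by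
        rw [nextPhase_eq_iff, Prod.ext_iff, Fin.ext_iff]
        have := x.2.2
        split_ifs <;> simp <;> omega
      simp only [hiff, mul_ite, mul_one, mul_zero]
      refine ite_congr rfl (fun hx => ?_) fun _ => rfl
      subst hx
      obtain ⟨m, rfl⟩ : ∃ n, m = n + 1 := ⟨m - 1, by omega⟩
      have hk1 : k - 1 + 1 = k := by omega
      simp only [erlangStationary, hk1, hz, h0, pow_zero, modGeom, Nat.add_sub_cancel]
      rcases Nat.eq_zero_or_pos m with rfl | hm
      · simp
      · obtain ⟨n, rfl⟩ : ∃ n, m = n + 1 := ⟨m - 1, by omega⟩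
        simp [pow_succ]; ring
  · have h := hasSum_ite_eq ((m, ⟨i - 1, by omega⟩) : ℕ × Fin k) (modGeom σ (z ^ (i : ℕ)) m / k)
    refine hasSum_of_eq h (fun x => ?_) rfl
    have hiff : (m, i) = nextPhase x ↔ x = (m, ⟨i - 1, by omega⟩) := by
      rw [nextPhase_eq_iff, Prod.ext_iff, Fin.ext_iff]
      split_ifs <;> simp <;> omega
    simp only [hiff, mul_ite, mul_one, mul_zero]
    refine ite_congr rfl (fun hx => ?_) fun _ => rfl
    subst hx
    simp [erlangStationary, Nat.sub_add_cancel h0]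

/-- Since the masses are affine in the weight, the balance equations in phase `i` reduce to the
scalar equation `lam z ^ i + mu φ_Y(σ) z ^ (i + 1) = (lam + mu) z ^ (i + 1)`. -/
theorem isErlangStationary (hp : p.support ⊆ Set.Icc 1 b) (hlam : 0 < lam) (hmu : 0 < mu)
    (hk : 1 ≤ k) {σ z : ℝ} (hσ : σ ∈ Set.Ico (0 : ℝ) 1) (hz : z ∈ Set.Icc (0 : ℝ) 1)
    (hzk : z ^ k = σ) (hzeq : z * (lam + mu * (1 - batchPGF p b σ)) = lam) :
    IsErlangStationary lam mu p k (erlangStationary k σ z) := by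
  have hk0 : (k : ℝ) ≠ 0 := Nat.cast_ne_zero.2 (by omega)
  have hL : lam + mu ≠ 0 := (add_pos hlam hmu).ne'
  have hzi : ∀ i : ℕ, z ^ i ∈ Set.Icc (0 : ℝ) 1 := fun i =>
    ⟨pow_nonneg hz.1 i, pow_le_one₀ hz.1 hz.2⟩
  refine ⟨fun x => div_nonneg (modGeom_nonneg hσ (hzi _) _) k.cast_nonneg, ?_, fun y => ?_⟩
  · have h : HasSum (fun x : ℕ × Fin k => ∑ i : Fin k,
        if x.2 = i then modGeom σ (z ^ ((i : ℕ) + 1)) x.1 / k else 0) (∑ _i : Fin k, 1 / (k : ℝ)) :=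
      hasSum_sum fun i _ => hasSum_fiber ((hasSum_modGeom hσ _).div_const (k : ℝ)) i
    refine hasSum_of_eq h (fun x => ?_) (by simp [hk0])
    simp [erlangStationary]
  · rw [hasSum_mul_generator_iff hp hlam hmu]
    set w := z ^ ((y.2 : ℕ) + 1) with hw
    have hφ := batchPGF_mem_Icc hp (Set.Ico_subset_Icc_self hσ)
    have hβ : w * batchPGF p b σ ∈ Set.Icc (0 : ℝ) 1 := by
      simpa using mul_pow_mem_Icc (hzi ((y.2 : ℕ) + 1)) hφ 1
    have hserv := hasSum_toReal_bind (modGeomPMF σ w hσ (hzi _)) (serviceStep p) y.1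
    rw [modGeomPMF_bind_serviceStep hp hσ (hzi _) hβ] at hserv
    simp only [toReal_modGeomPMF] at hserv
    have h := (((hasSum_erlangStationary_nextPhase hzk y).mul_left lam).add
      ((hasSum_fiber (hserv.div_const (k : ℝ)) y.2).mul_left mu)).div_const (lam + mu)
    refine hasSum_of_eq h (fun x => ?_) ?_
    · rw [erlangMatrix]
      by_cases hx : x.2 = y.2
      · simp only [hx, if_true, erlangStationary, hw]
        ring
      · simp only [hx, Ne.symm hx, if_false, erlangStationary]
        ring
    · have hwz : lam * z ^ (y.2 : ℕ) + mu * (w * batchPGF p b σ) = (lam + mu) * w := by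
        rw [hw, pow_succ]
        linear_combination (-z ^ (y.2 : ℕ)) * hzeq
      simp only [erlangStationary, ← hw]
      rw [modGeom_affine σ (z ^ (y.2 : ℕ)), modGeom_affine σ (w * _), modGeom_affine σ w]
      field_simp
      linear_combination (-(modGeom σ 1 y.1 - modGeom σ 0 y.1)) * hwz

end

/-! ### Rotation-invariant laws on `[0, T)` -/

section

variable {T : ℝ}

/-- The uniform distribution on `[0, T)`. -/
def uniformIco (T : ℝ) : Measure ℝ := (ENNReal.ofReal T)⁻¹ • volume.restrict (Set.Ico 0 T)

/-- The time since the last arrival, `t` time units after it has been `s`. -/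
def rotate (T t s : ℝ) : ℝ := s + t - ⌊(s + t) / T⌋₊ * T

theorem measurable_rotate (T t : ℝ) : Measurable (rotate T t) := by
  have h : Measurable fun s : ℝ => ⌊(s + t) / T⌋₊ :=
    Nat.measurable_floor.comp ((measurable_id.add_const t).div_const T)
  exact (measurable_id.add_const t).sub
    (((measurable_of_countable (Nat.cast : ℕ → ℝ)).comp h).mul_const T)

theorem rotate_mem_Ico (hT : 0 < T) {t s : ℝ} (ht : 0 ≤ t) (hs : s ∈ Set.Ico 0 T) :
    rotate T t s ∈ Set.Ico 0 T := by
  have h0 : 0 ≤ (s + t) / T := div_nonneg (add_nonneg hs.1 ht) hT.le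
  have h1 := Nat.floor_le h0
  have h2 := Nat.lt_floor_add_one ((s + t) / T)
  rw [le_div_iff₀ hT] at h1
  rw [div_lt_iff₀ hT] at h2
  constructor <;> simp only [rotate] <;> linarith

theorem coe_rotate (T t s : ℝ) : (rotate T t s : AddCircle T) = (t : AddCircle T) + s := by
  rw [rotate, ← nsmul_eq_mul, AddCircle.coe_sub, AddCircle.coe_nsmul, AddCircle.coe_period,
    smul_zero, sub_zero, AddCircle.coe_add, add_comm]

theorem rotate_period (hT : 0 < T) {s : ℝ} (hs : s ∈ Set.Ico 0 T) :
    ⌊(s + T) / T⌋₊ = 1 ∧ rotate T T s = s := by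
  have h : ⌊(s + T) / T⌋₊ = 1 := by
    have h0 : 0 ≤ s / T := div_nonneg hs.1 hT.le
    rw [add_div, div_self hT.ne', Nat.floor_add_one h0,
      Nat.floor_eq_zero.2 ((div_lt_one hT).2 hs.2)]
  exact ⟨h, by rw [rotate, h]; simp⟩

/-- A law on `[0, T)` is determined by its image on the circle. -/
theorem eq_of_map_addCircle_eq (hT : 0 < T) {τ τ' : Measure ℝ} (hτ : ∀ᵐ s ∂τ, s ∈ Set.Ico 0 T)
    (hτ' : ∀ᵐ s ∂τ', s ∈ Set.Ico 0 T)
    (h : τ.map ((↑) : ℝ → AddCircle T) = τ'.map ((↑) : ℝ → AddCircle T)) : τ = τ' := by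
  have : Fact (0 < T) := ⟨hT⟩
  have hr : Measurable fun θ : AddCircle T => (AddCircle.equivIco T 0 θ : ℝ) :=
    measurable_subtype_coe.comp (AddCircle.measurableEquivIco T 0).measurable
  have key : ∀ τ : Measure ℝ, (∀ᵐ s ∂τ, s ∈ Set.Ico 0 T) →
      (τ.map ((↑) : ℝ → AddCircle T)).map (fun θ => (AddCircle.equivIco T 0 θ : ℝ)) = τ := by
    intro τ hτ
    rw [Measure.map_map hr AddCircle.measurable_mk']
    conv_rhs => rw [← Measure.map_id (μ := τ)]
    refine Measure.map_congr ?_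
    filter_upwards [hτ] with s hs
    exact AddCircle.equivIco_coe_of_mem (by rwa [zero_add])
  rw [← key τ hτ, h, key τ' hτ']

theorem ae_uniformIco_mem (T : ℝ) : ∀ᵐ s ∂uniformIco T, s ∈ Set.Ico 0 T :=
  Measure.ae_smul_measure (ae_restrict_mem measurableSet_Ico) _

theorem map_addCircle_uniformIco [Fact (0 < T)] :
    (uniformIco T).map ((↑) : ℝ → AddCircle T) = (ENNReal.ofReal T)⁻¹ • volume := by
  have h := (AddCircle.measurePreserving_mk T 0).map_eq
  rw [zero_add, ← restrict_Ico_eq_restrict_Ioc] at h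
  rw [uniformIco, Measure.map_smul, h]

theorem isProbabilityMeasure_uniformIco (hT : 0 < T) : IsProbabilityMeasure (uniformIco T) :=
  ⟨by simp [uniformIco, ENNReal.inv_mul_cancel, hT]⟩

theorem map_rotate_uniformIco (hT : 0 < T) {t : ℝ} (ht : 0 ≤ t) :
    (uniformIco T).map (rotate T t) = uniformIco T := by
  have : Fact (0 < T) := ⟨hT⟩
  refine eq_of_map_addCircle_eq hT ?_ (ae_uniformIco_mem T) ?_
  · refine (ae_map_iff (p := fun s => s ∈ Set.Ico 0 T) (measurable_rotate T t).aemeasurable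
      measurableSet_Ico).2 ?_
    exact (ae_uniformIco_mem T).mono fun s hs => rotate_mem_Ico hT ht hs
  · have hcomp : ((↑) : ℝ → AddCircle T) ∘ rotate T t =
        (fun θ => (t : AddCircle T) + θ) ∘ ((↑) : ℝ → AddCircle T) :=
      funext fun s => coe_rotate T t s
    rw [Measure.map_map AddCircle.measurable_mk' (measurable_rotate T t), hcomp,
      ← Measure.map_map (measurable_const_add _) AddCircle.measurable_mk',
      map_addCircle_uniformIco, Measure.map_smul, map_add_left_eq_self]

/-- The uniform distribution is the only rotation-invariant law on `[0, T)`, by uniqueness of the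
Haar measure on the circle. -/
theorem eq_uniformIco (hT : 0 < T) {τ : Measure ℝ} [IsProbabilityMeasure τ]
    (hτ : ∀ᵐ s ∂τ, s ∈ Set.Ico 0 T) (hinv : ∀ t, 0 ≤ t → τ.map (rotate T t) = τ) :
    τ = uniformIco T := by
  have : Fact (0 < T) := ⟨hT⟩
  have := isProbabilityMeasure_uniformIco hT
  have hc : Measurable ((↑) : ℝ → AddCircle T) := AddCircle.measurable_mk'
  have : IsProbabilityMeasure (τ.map ((↑) : ℝ → AddCircle T)) :=
    Measure.isProbabilityMeasure_map hc.aemeasurable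
  have : IsProbabilityMeasure ((uniformIco T).map ((↑) : ℝ → AddCircle T)) :=
    Measure.isProbabilityMeasure_map hc.aemeasurable
  have : (τ.map ((↑) : ℝ → AddCircle T)).IsAddLeftInvariant := ⟨fun g => by
    obtain ⟨t, ht, rfl⟩ : ∃ t : ℝ, 0 ≤ t ∧ (t : AddCircle T) = g :=
      ⟨AddCircle.equivIco T 0 g, (AddCircle.equivIco T 0 g).2.1, AddCircle.coe_equivIco⟩
    have hcomp : (fun θ => (t : AddCircle T) + θ) ∘ ((↑) : ℝ → AddCircle T) =
        ((↑) : ℝ → AddCircle T) ∘ rotate T t := funext fun s => (coe_rotate T t s).symm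
    rw [Measure.map_map (measurable_const_add _) hc, hcomp,
      ← Measure.map_map hc (measurable_rotate T t), hinv t ht]⟩
  have : (τ.map ((↑) : ℝ → AddCircle T)).IsAddHaarMeasure :=
    Measure.isAddHaarMeasure_of_isCompact_nonempty_interior _ Set.univ isCompact_univ
      (by simp) (by simp) (by simp)
  have : ((uniformIco T).map ((↑) : ℝ → AddCircle T)).IsAddHaarMeasure := by
    rw [map_addCircle_uniformIco]
    exact Measure.IsAddHaarMeasure.smul _ (by simp) (by simp [hT])
  exact eq_of_map_addCircle_eq hT hτ (ae_uniformIco_mem T)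
    (Measure.isAddHaarMeasure_eq_of_isProbabilityMeasure _ _)

end

/-! ### The queue with deterministic inter-arrival times: existence -/

/-- The kernel given by a measurable family of laws on `ℕ`. -/
def pmfKernel {α : Type*} [MeasurableSpace α] (f : α → PMF ℕ)
    (hf : ∀ j, Measurable fun a => f a j) : Kernel α ℕ :=
  ⟨fun a => (f a).toMeasure, Measure.measurable_of_measurable_coe _ fun A hA => by
    simp only [PMF.toMeasure_apply _ hA]
    refine Measurable.tsum fun j => ?_
    by_cases h : j ∈ A
    · simpa [Set.indicator, h] using hf j
    · simp [Set.indicator, h]⟩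

instance {α : Type*} [MeasurableSpace α] (f : α → PMF ℕ) (hf : ∀ j, Measurable fun a => f a j) :
    IsMarkovKernel (pmfKernel f hf) :=
  ⟨fun a => PMF.toMeasure.isProbabilityMeasure (f a)⟩

theorem pmfKernel_apply {α : Type*} [MeasurableSpace α] (f : α → PMF ℕ)
    (hf : ∀ j, Measurable fun a => f a j) (a : α) : pmfKernel f hf a = (f a).toMeasure := rfl

theorem lintegral_toMeasure (q : PMF ℕ) (f : ℕ → ENNReal) :
    ∫⁻ m, f m ∂q.toMeasure = ∑' m, q m * f m := by
  rw [lintegral_countable']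
  refine tsum_congr fun m => ?_
  rw [PMF.toMeasure_apply_singleton _ _ (measurableSet_singleton m), mul_comm]

section

variable {p : PMF ℕ} {b : ℕ} {mu T σ : ℝ}

theorem deterministicKernel_apply (mu : ℝ) (p : PMF ℕ) (T t : ℝ) (x : ℕ × ℝ) {A : Set (ℕ × ℝ)}
    (hA : MeasurableSet A) : deterministicKernel mu p T t x A =
      (customersAfter mu p T t x.1 x.2 ⌊(x.2 + t) / T⌋₊).toMeasure
        ((fun m => (m, rotate T t x.2)) ⁻¹' A) :=
  Measure.map_apply (measurable_of_countable _) hA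

theorem bind_iterate_cycle (q : PMF ℕ) (f : ℕ → PMF ℕ) (n : ℕ) :
    q.bind (fun m => (cycle mu p T)^[n] (f m)) = (cycle mu p T)^[n] (q.bind f) := by
  induction n with
  | zero => rfl
  | succ n ih =>
    simp only [Function.iterate_succ_apply', ← ih]
    simp only [cycle, ← PMF.map_bind, PMF.bind_bind]

/-- The conditional law of the number of customers, when the last arrival was `s` time units ago
(for `s ≥ 0`; negative times are replaced by `0`): the weight of the modified geometric law is `1`
right after an arrival and decays at rate `c = μ (1 - φ_Y(σ))`. -/
def customersLaw (σ c : ℝ) (hσ : σ ∈ Set.Ico (0 : ℝ) 1) (hc : 0 ≤ c) (s : ℝ) : PMF ℕ :=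
  modGeomPMF σ (Real.exp (-(c * max s 0))) hσ (exp_neg_mul_mem_Icc hc (le_max_right s 0))

theorem measurable_customersLaw {c : ℝ} (hσ : σ ∈ Set.Ico (0 : ℝ) 1) (hc : 0 ≤ c) (j : ℕ) :
    Measurable fun s => customersLaw σ c hσ hc s j := by
  simp only [customersLaw, modGeomPMF_apply, modGeom_affine σ (Real.exp _)]
  fun_prop

/-- The laws `customersLaw` evolve consistently: if the decay over a full period turns the weight
`1` into `σ`, then an arrival turns it back into `1`. -/
theorem customersLaw_bind_customersAfter (hp : p.support ⊆ Set.Icc 1 b) (hmu : 0 ≤ mu)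
    (hT : 0 < T) (hσ : σ ∈ Set.Ico (0 : ℝ) 1) (hc : 0 ≤ mu * (1 - batchPGF p b σ))
    (hσT : Real.exp (-(mu * (1 - batchPGF p b σ) * T)) = σ) {t s : ℝ} (ht : 0 ≤ t)
    (hs : s ∈ Set.Ico 0 T) :
    (customersLaw σ _ hσ hc s).bind
        (fun m => customersAfter mu p T t m s ⌊(s + t) / T⌋₊) =
      customersLaw σ _ hσ hc (rotate T t s) := by
  have hrot := rotate_mem_Ico hT ht hs
  have h1 : (1 : ℝ) ∈ Set.Icc (0 : ℝ) 1 := Set.right_mem_Icc.2 zero_le_one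
  rcases hn : ⌊(s + t) / T⌋₊ with _ | n
  · refine modGeomPMF_bind_serve hp hmu ht hσ _ _ ?_
    rw [max_eq_left hs.1, max_eq_left hrot.1, rotate, hn, ← Real.exp_add]
    simp only [Nat.cast_zero, zero_mul, sub_zero]
    ring_nf
  · have hfix : ∀ n, (cycle mu p T)^[n] (modGeomPMF σ 1 hσ h1) = modGeomPMF σ 1 hσ h1 :=
      fun n => Function.iterate_fixed (by
        rw [cycle, modGeomPMF_bind_serve hp hmu hT.le hσ h1 (Set.Ico_subset_Icc_self hσ)
          (by rw [one_mul, hσT]), map_succ_modGeomPMF]) n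
    have hfirst : (customersLaw σ _ hσ hc s).bind
        (fun m => (serve mu p (T - s) m).map Nat.succ) = modGeomPMF σ 1 hσ h1 := by
      rw [← PMF.map_bind, customersLaw, modGeomPMF_bind_serve hp hmu (sub_nonneg.2 hs.2.le) hσ _
        (Set.Ico_subset_Icc_self hσ), map_succ_modGeomPMF]
      rw [max_eq_left hs.1, ← Real.exp_add]
      conv_lhs => rw [← hσT]
      ring_nf
    have hr : s + t - (n + 1) * T = rotate T t s := by
      rw [rotate, hn]; push_cast; ring
    simp only [customersAfter, hr]
    rw [← PMF.bind_bind, bind_iterate_cycle, hfirst, hfix]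
    refine modGeomPMF_bind_serve hp hmu hrot.1 hσ _ _ ?_
    rw [max_eq_left hrot.1, one_mul]

/-- The stationary distribution: the time since the last arrival is uniform, and given that time
the number of customers has the law `customersLaw`. -/
def deterministicStationary (T σ c : ℝ) (hσ : σ ∈ Set.Ico (0 : ℝ) 1) (hc : 0 ≤ c) :
    Measure (ℕ × ℝ) :=
  (uniformIco T ⊗ₘ pmfKernel (customersLaw σ c hσ hc) (measurable_customersLaw hσ hc)).map
    Prod.swap

theorem deterministicStationary_apply {c : ℝ} (hT : 0 < T) (hσ : σ ∈ Set.Ico (0 : ℝ) 1)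
    (hc : 0 ≤ c) {A : Set (ℕ × ℝ)} (hA : MeasurableSet A) :
    deterministicStationary T σ c hσ hc A =
      ∫⁻ s, (customersLaw σ c hσ hc s).toMeasure ((fun m => (m, s)) ⁻¹' A) ∂uniformIco T := by
  have := isProbabilityMeasure_uniformIco hT
  rw [deterministicStationary, Measure.map_apply measurable_swap hA,
    Measure.compProd_apply (measurable_swap hA)]
  rfl

theorem isDeterministicStationary (hp : p.support ⊆ Set.Icc 1 b) (hmu : 0 ≤ mu)
    (hT : 0 < T) (hσ : σ ∈ Set.Ico (0 : ℝ) 1) (hc : 0 ≤ mu * (1 - batchPGF p b σ))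
    (hσT : Real.exp (-(mu * (1 - batchPGF p b σ) * T)) = σ) :
    IsDeterministicStationary mu p T (deterministicStationary T σ _ hσ hc) := by
  have := isProbabilityMeasure_uniformIco hT
  refine ⟨Measure.isProbabilityMeasure_map measurable_swap.aemeasurable, ?_, fun t ht => ?_⟩
  · refine (ae_map_iff (p := fun x : ℕ × ℝ => x.2 ∈ Set.Ico 0 T) measurable_swap.aemeasurable
      (measurable_snd measurableSet_Ico)).2 ?_
    have h := ae_uniformIco_mem T
    rw [← Measure.fst_compProd (uniformIco T)
      (pmfKernel (customersLaw σ _ hσ hc) (measurable_customersLaw hσ hc)), Measure.fst] at h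
    exact ae_of_ae_map measurable_fst.aemeasurable h
  · refine Measure.ext fun A hA => ?_
    rw [Measure.bind_apply hA (Kernel.aemeasurable _), deterministicStationary_apply hT hσ hc hA]
    conv_rhs => rw [← map_rotate_uniformIco hT ht]
    have hmeas : Measurable fun s =>
        (customersLaw σ _ hσ hc s).toMeasure ((fun m => (m, s)) ⁻¹' A) := by
      have h := Kernel.measurable_kernel_prodMk_left (t := Prod.swap ⁻¹' A)
        (κ := pmfKernel (customersLaw σ _ hσ hc) (measurable_customersLaw hσ hc))
        (measurable_swap hA)
      exact h
    have hK : Measurable fun x => deterministicKernel mu p T t x A :=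
      Kernel.measurable_coe _ hA
    rw [lintegral_map hmeas (measurable_rotate T t), deterministicStationary,
      lintegral_map hK measurable_swap, Measure.lintegral_compProd (f := fun a =>
        deterministicKernel mu p T t a.swap A) (hK.comp measurable_swap)]
    refine lintegral_congr_ae ?_
    filter_upwards [ae_uniformIco_mem T] with s hs
    rw [← customersLaw_bind_customersAfter hp hmu hT hσ hc hσT ht hs,
      PMF.toMeasure_bind_apply _ _ _ (measurable_of_countable _ hA), pmfKernel_apply,
      lintegral_toMeasure]
    exact tsum_congr fun m => by rw [Prod.swap_prod_mk, deterministicKernel_apply _ _ _ _ _ hA]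

theorem real_deterministicStationary {c : ℝ} (hT : 0 < T) (hσ : σ ∈ Set.Ico (0 : ℝ) 1)
    (hc : 0 < c) (hσT : Real.exp (-(c * T)) = σ) (m : ℕ) :
    (deterministicStationary T σ c hσ hc.le).real ({m} ×ˢ Set.univ) =
      modGeom σ ((1 - σ) / (c * T)) m := by
  have := isProbabilityMeasure_uniformIco hT
  have hpre : ∀ s : ℝ, (fun n : ℕ => (n, s)) ⁻¹' ({m} ×ˢ Set.univ) = {m} := fun s => by
    ext n; simp
  have hexp : ∫ s, Real.exp (-(c * max s 0)) ∂uniformIco T = (1 - σ) / (c * T) := by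
    rw [uniformIco, integral_smul_measure, setIntegral_congr_fun (g := fun s => Real.exp (-c * s))
      measurableSet_Ico (fun s hs => by simp only [max_eq_left hs.1, neg_mul]),
      integral_Ico_eq_integral_Ioc, ← intervalIntegral.integral_of_le hT.le,
      intervalIntegral.integral_comp_mul_left _ (neg_ne_zero.2 hc.ne'), integral_exp,
      neg_mul, hσT, ENNReal.toReal_inv, ENNReal.toReal_ofReal hT.le]
    simp only [mul_zero, Real.exp_zero, smul_eq_mul]
    field_simp
    ring
  have hint : Integrable (fun s => Real.exp (-(c * max s 0))) (uniformIco T) := by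
    refine Integrable.of_bound (by fun_prop) 1 (ae_of_all _ fun s => ?_)
    rw [Real.norm_of_nonneg (Real.exp_pos _).le]
    exact (exp_neg_mul_mem_Icc hc.le (le_max_right s 0)).2
  rw [Measure.real, deterministicStationary_apply hT hσ hc.le
    ((measurableSet_singleton m).prod MeasurableSet.univ)]
  simp only [hpre, PMF.toMeasure_apply_singleton _ _ (measurableSet_singleton m), customersLaw,
    modGeomPMF_apply]
  rw [← integral_eq_lintegral_of_nonneg_ae
    (ae_of_all _ fun s => modGeom_nonneg hσ (exp_neg_mul_mem_Icc hc.le (le_max_right s 0)) m)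
    (by simp only [modGeom_affine σ (Real.exp _)]; fun_prop)]
  simp only [modGeom_affine σ (Real.exp _)]
  rw [integral_add (integrable_const _) (hint.mul_const _), integral_mul_const, hexp,
    modGeom_affine σ ((1 - σ) / (c * T))]
  simp

end

/-! ### The queue with deterministic inter-arrival times: uniqueness -/

section

variable {p : PMF ℕ} {b : ℕ} {mu T σ : ℝ}

theorem zero_mem_support_iterate (hp : p.support ⊆ Set.Icc 1 b) {m n : ℕ} (h : m ≤ n) :
    0 ∈ ((fun q : PMF ℕ => q.bind (serviceStep p))^[n] (PMF.pure m)).support := by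
  induction n generalizing m with
  | zero =>
    obtain rfl : m = 0 := by omega
    simp
  | succ n ih =>
    obtain ⟨j, hj⟩ := p.support_nonempty
    have hj1 := (hp hj).1
    rw [Function.iterate_succ_apply, PMF.pure_bind, ← bind_iterate_pure, PMF.mem_support_bind_iff]
    refine ⟨m - j, ?_, ih (by omega)⟩
    rw [serviceStep, PMF.mem_support_map_iff]
    exact ⟨j, hj, rfl⟩

theorem zero_mem_support_serve (hp : p.support ⊆ Set.Icc 1 b) (hmu : 0 < mu) {t : ℝ} (ht : 0 < t)
    (m : ℕ) : 0 ∈ (serve mu p t m).support := by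
  rw [serve, PMF.mem_support_bind_iff]
  refine ⟨m, fun h => ?_, zero_mem_support_iterate hp le_rfl⟩
  have h1 := toReal_poisson (mu * t).toNNReal m
  rw [h, Real.coe_toNNReal _ (mul_pos hmu ht).le] at h1
  have : 0 < Real.exp (-(mu * t)) * (mu * t) ^ m / m.factorial := by positivity
  exact this.ne h1

theorem self_mem_support_serve (mu : ℝ) (p : PMF ℕ) (t : ℝ) (m : ℕ) :
    m ∈ (serve mu p t m).support := by
  rw [serve, PMF.mem_support_bind_iff]
  refine ⟨0, fun h => ?_, by simp⟩
  have h1 := toReal_poisson (mu * t).toNNReal 0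
  rw [h] at h1
  have : 0 < Real.exp (-((mu * t).toNNReal : ℝ)) * ((mu * t).toNNReal : ℝ) ^ 0 /
    (Nat.factorial 0 : ℝ) := by simp [Real.exp_pos]
  exact this.ne h1

/-- Over one period, every state may be taken to a single customer: the server may empty the
system before the arrival and be idle after it. -/
theorem one_mem_support_customersAfter (hp : p.support ⊆ Set.Icc 1 b) (hmu : 0 < mu) {s : ℝ}
    (hs : s ∈ Set.Ico 0 T) (m : ℕ) : 1 ∈ (customersAfter mu p T T m s 1).support := by
  rw [customersAfter, PMF.mem_support_bind_iff]
  refine ⟨1, ?_, self_mem_support_serve _ _ _ _⟩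
  rw [Function.iterate_zero_apply, PMF.mem_support_map_iff]
  exact ⟨0, zero_mem_support_serve hp hmu (sub_pos.2 hs.2) m, rfl⟩

theorem pmf_invariant_unique {K : ℕ → PMF ℕ} {o : ℕ} (ho : ∀ x, o ∈ (K x).support) {q q' : PMF ℕ}
    (hq : q.bind K = q) (hq' : q'.bind K = q') : q = q' := by
  have h := invariant_unique_of_reaches (P := fun x y => (K x y).toReal)
    (fun _ _ => ENNReal.toReal_nonneg) (fun x => hasSum_toReal (K x)) o
    (fun x => Relation.ReflTransGen.single (ENNReal.toReal_pos (ho x) (PMF.apply_ne_top _ _)))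
    (hasSum_toReal q) (hasSum_toReal q')
    (fun y => by simpa only [hq] using hasSum_toReal_bind q K y)
    (fun y => by simpa only [hq'] using hasSum_toReal_bind q' K y)
  exact PMF.ext fun m => (ENNReal.toReal_eq_toReal_iff' (PMF.apply_ne_top _ _)
    (PMF.apply_ne_top _ _)).1 (congrFun h m)

/-- The time since the last arrival is uniform under each stationary distribution. -/
theorem IsDeterministicStationary.snd_eq (hT : 0 < T) {ν : Measure (ℕ × ℝ)}
    (hν : IsDeterministicStationary mu p T ν) : ν.map Prod.snd = uniformIco T := by
  obtain ⟨hprob, hae, hinv⟩ := hν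
  have : IsProbabilityMeasure (ν.map Prod.snd) :=
    Measure.isProbabilityMeasure_map measurable_snd.aemeasurable
  refine eq_uniformIco hT ((ae_map_iff (p := fun s => s ∈ Set.Ico 0 T)
    measurable_snd.aemeasurable measurableSet_Ico).2 hae) fun t ht => ?_
  refine Measure.ext fun B hB => ?_
  have hmeas : Measurable (rotate T t ∘ Prod.snd : ℕ × ℝ → ℝ) :=
    (measurable_rotate T t).comp measurable_snd
  rw [Measure.map_map (measurable_rotate T t) measurable_snd, Measure.map_apply hmeas hB,
    Measure.map_apply measurable_snd hB]
  have h : (ν.bind (deterministicKernel mu p T t)) (Prod.snd ⁻¹' B) = ν (Prod.snd ⁻¹' B) :=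
    congrArg (fun ν : Measure (ℕ × ℝ) => ν (Prod.snd ⁻¹' B)) (hinv t ht)
  rw [← h, Measure.bind_apply (measurable_snd hB) (Kernel.aemeasurable _),
    ← lintegral_indicator_one (hmeas hB)]
  refine lintegral_congr fun x => ?_
  rw [deterministicKernel_apply _ _ _ _ _ (measurable_snd hB)]
  have := PMF.toMeasure.isProbabilityMeasure (customersAfter mu p T t x.1 x.2 ⌊(x.2 + t) / T⌋₊)
  by_cases hx : rotate T t x.2 ∈ B
  · simp [Set.indicator, hx, Set.preimage]
  · simp [Set.indicator, hx, Set.preimage]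

theorem measurable_customersAfter_period (mu : ℝ) (p : PMF ℕ) (T : ℝ) (j : ℕ) :
    Measurable fun x : ℝ × ℕ => customersAfter mu p T T x.2 x.1 1 j :=
  measurable_from_prod_countable_left fun m => measurable_customersAfter mu p T T m 1 j

/-- Given the time `s` since the last arrival, a stationary law of the number of customers is
invariant under the transition over one period, which returns to the same `s`. -/
theorem IsDeterministicStationary.condKernel_bind (hT : 0 < T) {ν : Measure (ℕ × ℝ)}
    [IsProbabilityMeasure (ν.map Prod.swap)] (hν : IsDeterministicStationary mu p T ν) :
    ∀ᵐ s ∂uniformIco T, ((ν.map Prod.swap).condKernel s).toPMF.bind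
      (fun m => customersAfter mu p T T m s 1) = ((ν.map Prod.swap).condKernel s).toPMF := by
  set η := ν.map Prod.swap with hη
  set L := pmfKernel (fun x : ℝ × ℕ => customersAfter mu p T T x.2 x.1 1)
    (measurable_customersAfter_period mu p T) with hL
  have hfst : η.fst = uniformIco T := by
    rw [hη, Measure.fst_map_swap]
    exact hν.snd_eq hT
  obtain ⟨hprob, hae, hinv⟩ := hν
  have hdis : η.fst ⊗ₘ η.condKernel = η := η.disintegrate η.condKernel
  have key : η = η.fst ⊗ₘ (η.condKernel ⊗ₖ L).snd := by
    refine Measure.ext fun A hA => ?_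
    have hA' := measurable_swap hA
    have h : (ν.bind (deterministicKernel mu p T T)) (Prod.swap ⁻¹' A) = ν (Prod.swap ⁻¹' A) :=
      congrArg (fun ν : Measure (ℕ × ℝ) => ν (Prod.swap ⁻¹' A)) (hinv T hT.le)
    have hmeas : Measurable fun x : ℝ × ℕ => L x (Prod.mk x.1 ⁻¹' A) :=
      Kernel.measurable_kernel_prodMk_left (κ := L) (t := {y : (ℝ × ℕ) × ℕ | (y.1.1, y.2) ∈ A})
        (hA.preimage ((measurable_fst.comp measurable_fst).prodMk measurable_snd))
    have hin : ∀ s, (η.condKernel ⊗ₖ L).snd s (Prod.mk s ⁻¹' A) =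
        ∫⁻ m, L (s, m) (Prod.mk s ⁻¹' A) ∂η.condKernel s := fun s => by
      have hAs : MeasurableSet (Prod.mk s ⁻¹' A) := measurable_prodMk_left hA
      rw [Kernel.snd_apply' _ _ hAs, Kernel.compProd_apply (measurable_snd hAs)]
      rfl
    rw [Measure.compProd_apply hA]
    simp only [hin]
    rw [← Measure.lintegral_compProd (f := fun x : ℝ × ℕ => L x (Prod.mk x.1 ⁻¹' A)) hmeas, hdis,
      hη, Measure.map_apply measurable_swap hA, ← h, lintegral_map hmeas measurable_swap,
      Measure.bind_apply hA' (Kernel.aemeasurable _)]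
    refine lintegral_congr_ae ?_
    filter_upwards [hae] with x hx
    obtain ⟨hfl, hrot⟩ := rotate_period hT hx
    rw [deterministicKernel_apply _ _ _ _ _ hA', hfl, hrot]
    rfl
  have hcond := eq_condKernel_of_measure_eq_compProd _ key
  rw [hfst] at hcond
  filter_upwards [hcond] with s hs
  refine PMF.ext fun y => ?_
  have hy := measurableSet_singleton y
  have h := congrArg (fun κ : Measure ℕ => κ {y}) hs
  simp only [Kernel.snd_apply' _ _ hy, Kernel.compProd_apply (measurable_snd hy)] at h
  rw [Measure.toPMF_apply, ← h, PMF.bind_apply, lintegral_countable']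
  refine tsum_congr fun m => ?_
  rw [Measure.toPMF_apply, mul_comm]
  congr 1
  exact (PMF.toMeasure_apply_singleton _ _ hy).symm

theorem IsDeterministicStationary.unique (hp : p.support ⊆ Set.Icc 1 b) (hmu : 0 < mu)
    (hT : 0 < T) (hσ : σ ∈ Set.Ico (0 : ℝ) 1) (hc : 0 ≤ mu * (1 - batchPGF p b σ))
    (hσT : Real.exp (-(mu * (1 - batchPGF p b σ) * T)) = σ) {ν : Measure (ℕ × ℝ)}
    (hν : IsDeterministicStationary mu p T ν) : ν = deterministicStationary T σ _ hσ hc := by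
  have := hν.1
  have : IsProbabilityMeasure (ν.map Prod.swap) :=
    Measure.isProbabilityMeasure_map measurable_swap.aemeasurable
  have hfst : (ν.map Prod.swap).fst = uniformIco T := by
    rw [Measure.fst_map_swap]
    exact hν.snd_eq hT
  have hdis : (ν.map Prod.swap).fst ⊗ₘ (ν.map Prod.swap).condKernel = ν.map Prod.swap :=
    (ν.map Prod.swap).disintegrate _
  have hcond : (ν.map Prod.swap).condKernel =ᵐ[uniformIco T]
      pmfKernel (customersLaw σ _ hσ hc) (measurable_customersLaw hσ hc) := by
    filter_upwards [hν.condKernel_bind hT, ae_uniformIco_mem T] with s hs hsT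
    have hstat := customersLaw_bind_customersAfter hp hmu.le hT hσ hc hσT hT.le hsT
    obtain ⟨hfl, hrot⟩ := rotate_period hT hsT
    rw [hfl, hrot] at hstat
    rw [pmfKernel_apply, ← pmf_invariant_unique
      (one_mem_support_customersAfter hp hmu hsT) hs hstat, Measure.toPMF_toMeasure]
  rw [deterministicStationary, ← Measure.compProd_congr hcond, ← hfst, hdis,
    Measure.map_map measurable_swap measurable_swap, Prod.swap_swap_eq, Measure.map_id]

end

/-! ### Convergence of the laws of the number of customers -/

theorem levelProb_erlangStationary {k : ℕ} {σ z : ℝ} (hk : 1 ≤ k) (hz1 : z ≠ 1) (hzk : z ^ k = σ)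
    (m : ℕ) : levelProb (erlangStationary k σ z) m =
      modGeom σ (z * (1 - σ) / (k * (1 - z))) m := by
  have hk0 : (k : ℝ) ≠ 0 := Nat.cast_ne_zero.2 (by omega)
  have hsum : ∑ i : Fin k, z ^ ((i : ℕ) + 1) = z * (1 - σ) / (1 - z) := by
    rw [Fin.sum_univ_eq_sum_range (fun i => z ^ (i + 1)) k]
    simp only [pow_succ]
    rw [← Finset.sum_mul, geom_sum_eq hz1, hzk, ← neg_sub σ 1, ← neg_sub z 1, mul_neg,
      neg_div_neg_eq]
    ring
  simp only [levelProb, erlangStationary, modGeom_affine σ (z ^ _)]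
  rw [← Finset.sum_div, Finset.sum_add_distrib, ← Finset.sum_mul, hsum,
    modGeom_affine σ (z * (1 - σ) / (k * (1 - z)))]
  simp only [Finset.sum_const, Finset.card_univ, Fintype.card_fin, nsmul_eq_mul]
  field_simp

/-- The stationary laws of the numbers of customers of all the queues are modified geometric of
the same form, with a weight that is a continuous function of the ratio. -/
theorem tendsto_modGeom {φ : ℝ → ℝ} {ρ σ : ℝ} (hφ : Continuous φ) (h1 : 1 - φ σ ≠ 0) {s : ℕ → ℝ}
    (hs : Tendsto s atTop (𝓝 σ)) (m : ℕ) :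
    Tendsto (fun k => modGeom (s k) (ρ * (1 - s k) / (1 - φ (s k))) m) atTop
      (𝓝 (modGeom σ (ρ * (1 - σ) / (1 - φ σ)) m)) := by
  have hw : Tendsto (fun k => ρ * (1 - s k) / (1 - φ (s k))) atTop
      (𝓝 (ρ * (1 - σ) / (1 - φ σ))) :=
    ((hs.const_sub 1).const_mul ρ).div (((hφ.tendsto σ).comp hs).const_sub 1) h1
  unfold modGeom
  split_ifs
  · exact hw.const_sub 1
  · exact (hw.mul (hs.const_sub 1)).mul (hs.pow _)

end

end BatchQueue

open BatchQueue in
theorem mainTheorem6 (lam mu : ℝ) (hlam : 0 < lam) (hmu : 0 < mu)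
    (b : ℕ) (p : PMF ℕ) (hp : p.support ⊆ Set.Icc 1 b)
    (ρ : ℝ) (hρ : ρ = lam / mu) (hergodic : ρ < BatchQueue.batchMean p b) :
    ∃ (σ : ℝ) (πD : Measure (ℕ × ℝ)) (π : (k : ℕ) → ℕ × Fin k → ℝ),
      -- `σ` is the unique root below `1`
      (σ < 1 ∧ σ = Real.exp (-(1 - BatchQueue.batchPGF p b σ) / ρ) ∧
        ∀ x : ℝ, x < 1 → x = Real.exp (-(1 - BatchQueue.batchPGF p b x) / ρ) → x = σ) ∧
      -- `πD` is the unique stationary distribution for deterministic inter-arrival times `1 / lam`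
      (BatchQueue.IsDeterministicStationary mu p (1 / lam) πD ∧
        ∀ ν, BatchQueue.IsDeterministicStationary mu p (1 / lam) ν → ν = πD) ∧
      -- `π k` is the unique stationary distribution for Erlang(`k`, `k * lam`) inter-arrival times
      (∀ k : ℕ, 1 ≤ k → BatchQueue.IsErlangStationary (k * lam) mu p k (π k) ∧
        ∀ ν, BatchQueue.IsErlangStationary (k * lam) mu p k ν → ν = π k) ∧
      -- convergence of the laws of the number of customers
      (∀ m : ℕ, Tendsto (fun k : ℕ => BatchQueue.levelProb (π k) m) atTop
        (𝓝 (πD.real ({m} ×ˢ Set.univ)))) ∧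
      -- the modified geometric law
      (∀ m : ℕ, 0 < m → πD.real ({m} ×ˢ Set.univ) =
        ρ * (1 - σ) ^ 2 / (1 - BatchQueue.batchPGF p b σ) * σ ^ (m - 1)) ∧
      πD.real ({0} ×ˢ Set.univ) =
        1 - ρ * (1 - σ) / (1 - BatchQueue.batchPGF p b σ) := by
  have hρ0 : 0 < ρ := hρ ▸ div_pos hlam hmu
  have hT : 0 < 1 / lam := one_div_pos.2 hlam
  obtain ⟨σ, hσ, hroot, huniq, hleast, hbelow⟩ := exists_root hp hρ0 hergodic
  have hσ' := Set.Ioo_subset_Ico_self hσ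
  have hφ : 0 < 1 - batchPGF p b σ := sub_pos.2 (batchPGF_lt_one hp hσ')
  have hc := mul_pos hmu hφ
  have hσT : Real.exp (-(mu * (1 - batchPGF p b σ) * (1 / lam))) = σ := by
    conv_rhs => rw [hroot, hρ]
    congr 1
    field_simp
  choose! s hs using fun (k : ℕ) (hk : 1 ≤ k) => exists_phase_root hp hρ0 hergodic hk
  -- The law of the number of customers in the deterministic queue.
  have hlevelD : ∀ m, (deterministicStationary (1 / lam) σ _ hσ' hc.le).real ({m} ×ˢ Set.univ) =
      modGeom σ (ρ * (1 - σ) / (1 - batchPGF p b σ)) m := fun m => by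
    rw [real_deterministicStationary hT hσ' hc hσT m, hρ]
    congr 1
    field_simp
  refine ⟨σ, deterministicStationary (1 / lam) σ _ hσ' hc.le,
    fun k => erlangStationary k (s k) (phaseFactor p b ρ k (s k)), ⟨hσ.2, hroot, huniq⟩,
    ⟨isDeterministicStationary hp hmu.le hT hσ' hc.le hσT,
      fun ν hν => hν.unique hp hmu hT hσ' hc.le hσT⟩, fun k hk => ?_, fun m => ?_, fun m hm => ?_, ?_⟩
  · obtain ⟨hsk, hfix, -⟩ := hs k hk
    have hk0 : (0 : ℝ) < k := Nat.cast_pos.2 hk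
    have hinv := one_le_phaseFactor_inv hp hρ0 k (Set.Ioo_subset_Icc_self hsk)
    have hstat : IsErlangStationary (k * lam) mu p k
        (erlangStationary k (s k) (phaseFactor p b ρ k (s k))) := by
      refine isErlangStationary hp (mul_pos hk0 hlam) hmu hk (Set.Ioo_subset_Ico_self hsk)
        (phaseFactor_mem_Icc hp hρ0 k (Set.Ioo_subset_Icc_self hsk)) hfix ?_
      have hne := (one_pos.trans_le hinv).ne'
      rw [phaseFactor, inv_mul_eq_iff_eq_mul₀ hne, hρ]
      field_simp
    exact ⟨hstat, fun ν hν => hstat.unique hp (mul_pos hk0 hlam) hmu hk hν⟩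
  · rw [hlevelD]
    refine (tendsto_modGeom continuous_batchPGF hφ.ne'
      (tendsto_phase_root hp hρ0 hσ hleast hbelow hs) m).congr' ?_
    filter_upwards [eventually_ge_atTop 1] with k hk
    obtain ⟨hsk, hfix, -⟩ := hs k hk
    have hk0 : (0 : ℝ) < k := Nat.cast_pos.2 hk
    have hφk : 0 < 1 - batchPGF p b (s k) :=
      sub_pos.2 (batchPGF_lt_one hp (Set.Ioo_subset_Ico_self hsk))
    have hne := (one_pos.trans_le
      (one_le_phaseFactor_inv hp hρ0 k (Set.Ioo_subset_Icc_self hsk))).ne'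
    have hz1 : phaseFactor p b ρ k (s k) ≠ 1 := fun h => by
      rw [h, one_pow] at hfix
      exact hsk.2.ne' hfix
    rw [levelProb_erlangStationary hk hz1 hfix]
    congr 1
    -- With `u = (1 - φ) / (ρ k)`, the phase factor `z = 1 / (1 + u)` satisfies `1 - z = z u`.
    have hz : (1 - phaseFactor p b ρ k (s k)) * (ρ * k) =
        phaseFactor p b ρ k (s k) * (1 - batchPGF p b (s k)) := by
      have h1 : phaseFactor p b ρ k (s k) * (1 + (1 - batchPGF p b (s k)) / ρ / k) = 1 :=
        inv_mul_cancel₀ hne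
      have h2 : (1 - batchPGF p b (s k)) / ρ / k * (ρ * k) = 1 - batchPGF p b (s k) := by
        field_simp
      linear_combination (-(ρ * k)) * h1 + phaseFactor p b ρ k (s k) * h2
    rw [div_eq_div_iff hφk.ne' (mul_ne_zero hk0.ne' (sub_ne_zero.2 hz1.symm))]
    linear_combination (1 - s k) * hz
  · rw [hlevelD, modGeom, if_neg hm.ne']
    ring
  · rw [hlevelD, modGeom, if_pos rfl]
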